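/- Let $(M,g)$ be a nonempty smooth Riemannian manifold of dimension $n\ge 2$. On $T^*M$ let $t(p)=\tfrac12 g^{-1}(p,p)$, let $X^H$ and $\theta^V$ denote the horizontal lift (with respect to the Levi-Civita connection of $g$) of a tangent vector $X$ and the vertical lift of a covector $\theta$, and let $\theta\mapsto\theta^\sharp$ be the musical isomorphism and $g_X=g(X,\cdot)$. Let $a_1,\dots,a_4,b_1,\dots,b_4,c_1,c_2,c_3,d_1,d_2,d_3$ be smooth real functions on $[0,\infty)$, and define, at every $p\in T^*M$ (all coefficients being evaluated at $t=t(p)$), the tensor field $J$ by $$JX^H=a_1 (g_X)^V+b_1\,p(X)\,p^V+a_4X^H+b_4\,p(X)\,(p^\sharp)^H,$$ $$J\theta^V=a_3\theta^V+b_3\,g^{-1}(p,\theta)\,p^V-a_2(\theta^\sharp)^H-b_2\,g^{-1}(p,\theta)\,(p^\sharp)^H,$$ and the symmetric bilinear form $G$ by $$G(X^H,Y^H)=c_1g(X,Y)+d_1\,p(X)p(Y),\qquad G(\theta^V,\eta^V)=c_2g^{-1}(\theta,\eta)+d_2\,g^{-1}(p,\theta)g^{-1}(p,\eta),$$ $$G(X^H,\theta^V)=G(\theta^V,X^H)=c_3\theta(X)+d_3\,p(X)g^{-1}(p,\theta).$$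 Assume that $a_1,\ a_2,\ a_1+2tb_1,\ a_2+2tb_2$ are positive for all $t\ge 0$, and that $(T^*M,G,J)$ is an almost Hermitian manifold: $J^2=-\mathrm{id}$, $G$ is positive definite, and $G(JX,JY)=G(X,Y)$ for all $X,Y$. Then there are smooth functions $\lambda,\mu$ on $[0,\infty)$ with $\lambda>0$, $\lambda+2t\mu>0$ and $$c_i=\lambda a_i,\qquad c_i+2td_i=(\lambda+2t\mu)(a_i+2tb_i)\qquad (i=1,2,3,\ t\ge 0),$$ and for any such $\lambda,\mu$ the structure $(T^*M,G,J)$ is almost Kähler, that is, the fundamental $2$-form $\Omega(X,Y)=G(X,JY)$ satisfies $d\Omega=0$, if and only if $$\mu(t)=\lambda'(t)\quad\text{for all } t\ge 0$$ (with the one-sided derivative at $t=0$). -/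

import Mathlib

open Set Bundle Manifold
open scoped ContDiff Topology

noncomputable section

namespace NaturalLift

/-! ### Differential forms on a manifold without boundary -/

section Forms

variable {V : Type*} [NormedAddCommGroup V] [NormedSpace ℝ V]
  {H : Type*} [TopologicalSpace H] (I : ModelWithCorners ℝ V H)
  {N : Type*} [TopologicalSpace N] [ChartedSpace H N]

/-- A (not necessarily continuous) differential `k`-form on `N`. -/
abbrev DiffForm (N : Type*) [TopologicalSpace N] [ChartedSpace H N] (k : ℕ) :=
  ∀ p : N, TangentSpace I p [⋀^Fin k]→L[ℝ] ℝ

variable {I}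

/-- The expression of the form `α` in the preferred chart `φ` at `p₀`, that is, the pull-back
`(φ⁻¹)^* α`, a form on an open subset of the model vector space `V`. -/
def DiffForm.inChart {k : ℕ} (α : DiffForm I N k) (p₀ : N) (z : V) : V [⋀^Fin k]→L[ℝ] ℝ :=
  (α ((extChartAt I p₀).symm z)).compContinuousLinearMap
    (mfderiv 𝓘(ℝ, V) I (extChartAt I p₀).symm z)

/-- The exterior derivative of `α` at `p₀`, computed in the preferred chart `φ` at `p₀`:
`(dα)_{p₀} = φ^* d((φ⁻¹)^* α)`. -/
def DiffForm.extDerivAt {k : ℕ} (α : DiffForm I N k) (p₀ : N) :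
    TangentSpace I p₀ [⋀^Fin (k + 1)]→L[ℝ] ℝ :=
  (extDeriv (α.inChart p₀) (extChartAt I p₀ p₀)).compContinuousLinearMap
    (mfderiv I 𝓘(ℝ, V) (extChartAt I p₀) p₀)

/-- The form `α` is closed: `dα = 0`. -/
def DiffForm.IsClosed {k : ℕ} (α : DiffForm I N k) : Prop :=
  ∀ p : N, α.extDerivAt p = 0

end Forms

/-! ### The cotangent bundle of a Riemannian manifold -/

/-- The model space `ℝⁿ`. -/
abbrev Model (n : ℕ) := EuclideanSpace ℝ (Fin n)

variable {n : ℕ} {M : Type*} [TopologicalSpace M] [ChartedSpace (Model n) M]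
  [IsManifold (𝓡 n) ∞ M]

/-- The cotangent space `T_x^*M`. -/
abbrev CotangentSpace (n : ℕ) {M : Type*} [TopologicalSpace M] [ChartedSpace (Model n) M]
    (x : M) := TangentSpace (𝓡 n) x →L[ℝ] Bundle.Trivial M ℝ x

/-- The cotangent bundle `T^*M`, with Mathlib's structure of smooth manifold on the total space of
a vector bundle: a chart `x^1, …, x^n` of `M` induces the chart `q^1, …, q^n, p_1, …, p_n`. -/
abbrev CotangentBundle (n : ℕ) (M : Type*) [TopologicalSpace M] [ChartedSpace (Model n) M] :=
  TotalSpace (Model n →L[ℝ] ℝ) (CotangentSpace n : M → Type _)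

/-- The model with corners of `T^*M`; its model vector space is `ℝⁿ × (ℝⁿ)^*`. -/
abbrev cotangentModel (n : ℕ) := (𝓡 n).prod 𝓘(ℝ, Model n →L[ℝ] ℝ)

/-- A smooth Riemannian metric on `M`. -/
abbrev Metric (n : ℕ) (M : Type*) [TopologicalSpace M] [ChartedSpace (Model n) M]
    [IsManifold (𝓡 n) ∞ M] :=
  ContMDiffRiemannianMetric (𝓡 n) ∞ (Model n) (fun x : M ↦ TangentSpace (𝓡 n) x)

variable (g : Metric n M)

/-- The musical map `T_xM → T_x^*M`, `X ↦ g_X = g(X, ·)`. -/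
def flat (x : M) : TangentSpace (𝓡 n) x →L[ℝ] CotangentSpace n x := g.inner x

/-- The inverse musical map `T_x^*M → T_xM`, `θ ↦ θ^♯`, with `g(θ^♯, Y) = θ(Y)`. -/
def sharp (x : M) : CotangentSpace n x →L[ℝ] TangentSpace (𝓡 n) x := (flat g x).inverse

theorem flat_sharp (x : M) (θ : CotangentSpace n x) : flat g x (sharp g x θ) = θ := by
  have hinj : Function.Injective (flat g x) := by
    rw [injective_iff_map_eq_zero]
    intro v hv
    by_contra hne
    have h1 := g.pos x v hne
    have h2 : flat g x v v = 0 := by rw [hv]; rfl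
    exact h1.ne' h2
  let f : Model n →L[ℝ] (Model n →L[ℝ] ℝ) := flat g x
  have hdim : Module.finrank ℝ (Model n) = Module.finrank ℝ (Model n →L[ℝ] ℝ) := by
    rw [← (LinearMap.toContinuousLinearMap (𝕜 := ℝ) (E := Model n) (F' := ℝ)).finrank_eq]
    exact (Subspace.dual_finrank_eq (K := ℝ) (V := Model n)).symm
  have hbij : Function.Bijective f :=
    ⟨hinj, (LinearMap.injective_iff_surjective_of_finrank_eq_finrank (f := (f : Model n →ₗ[ℝ] _))
      hdim).1 hinj⟩
  let F : Model n ≃L[ℝ] (Model n →L[ℝ] ℝ) :=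
    (LinearEquiv.ofBijective (f : Model n →ₗ[ℝ] _) hbij).toContinuousLinearEquiv
  have hF : (F : Model n →L[ℝ] (Model n →L[ℝ] ℝ)) = f := by ext; rfl
  have key : f (f.inverse θ) = θ := by
    rw [← hF, ContinuousLinearMap.inverse_equiv]
    exact F.apply_symm_apply θ
  exact key

/-- The cometric `g⁻¹_x(θ, η)` on `T_x^*M`. -/
def cometric (x : M) (θ η : CotangentSpace n x) : ℝ := θ (sharp g x η)

/-- The energy density `t = ½ g⁻¹(p, p)`. -/
def energy (p : CotangentBundle n M) : ℝ := (1 / 2) * cometric g p.proj p.2 p.2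

/-! ### Christoffel symbols, horizontal and vertical lifts -/

/-- The `i`-th vector of the standard basis of `ℝⁿ`. -/
def e (i : Fin n) : Model n := EuclideanSpace.single i 1

/-- The `i`-th vector of the dual basis, `dx^i`. -/
def dx (i : Fin n) : Model n →L[ℝ] ℝ := EuclideanSpace.proj i

/-- The component `g_{ij} = g(∂/∂x^i, ∂/∂x^j)` of the metric in the preferred chart at `x₀`, as a
function of the coordinates `y`. -/
def metricComp (x₀ : M) (i j : Fin n) (y : Model n) : ℝ :=
  g.inner ((extChartAt (𝓡 n) x₀).symm y)
    (mfderiv 𝓘(ℝ, Model n) (𝓡 n) (extChartAt (𝓡 n) x₀).symm y (e i))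
    (mfderiv 𝓘(ℝ, Model n) (𝓡 n) (extChartAt (𝓡 n) x₀).symm y (e j))

/-- The partial derivative `∂g_{jk}/∂x^i` at `x`, in the preferred chart at `x`. -/
def dMetricComp (x : M) (i j k : Fin n) : ℝ :=
  fderiv ℝ (metricComp g x j k) (extChartAt (𝓡 n) x x) (e i)

/-- The Christoffel symbol
`Γ^k_{ih} = ½ g^{kl} (∂_i g_{hl} + ∂_h g_{il} - ∂_l g_{ih})` of `g` at `x`, in the preferred chart
at `x` (in which `T_xM` is identified with `ℝⁿ`, so that `g^{kl} = g⁻¹(dx^k, dx^l)`). -/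
def christoffel (x : M) (k i h : Fin n) : ℝ :=
  (1 / 2) * ∑ l, cometric g x (dx k) (dx l) *
    (dMetricComp g x i h l + dMetricComp g x h i l - dMetricComp g x l i h)

/-- `Γ^0_{ih} = p_k Γ^k_{ih}`. -/
def christoffelZero (p : CotangentBundle n M) (i h : Fin n) : ℝ :=
  ∑ k, p.2 (e k) * christoffel g p.proj k i h

/-- The linear map `X ↦ Γ^0_{ih} X^i dx^h`. -/
def christoffelMap (p : CotangentBundle n M) : Model n →L[ℝ] (Model n →L[ℝ] ℝ) :=
  ∑ i, ∑ h, christoffelZero g p i h • (dx i).smulRight (dx h)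

/-- The horizontal lift `X ↦ X^H_p`, with `(∂/∂x^i)^H = ∂/∂q^i + Γ^0_{ih} ∂/∂p_h` in the induced
chart. -/
def horizontalLift (p : CotangentBundle n M) (X : TangentSpace (𝓡 n) p.proj) :
    TangentSpace (cotangentModel n) p :=
  ((X, christoffelMap g p X) : Model n × (Model n →L[ℝ] ℝ))

/-- The vertical lift `θ ↦ θ^V_p`, with `(dx^i)^V = ∂/∂p_i` in the induced chart. -/
def verticalLift (p : CotangentBundle n M) (θ : CotangentSpace n p.proj) :
    TangentSpace (cotangentModel n) p :=
  ((0, θ) : Model n × (Model n →L[ℝ] ℝ))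

/-- The vector `X = π_* ξ` in the decomposition `ξ = X^H + θ^V`. -/
def horizontalPart (p : CotangentBundle n M) (ξ : TangentSpace (cotangentModel n) p) :
    TangentSpace (𝓡 n) p.proj :=
  Prod.fst (α := Model n) (β := Model n →L[ℝ] ℝ) ξ

/-- The covector `θ` in the decomposition `ξ = X^H + θ^V`. -/
def verticalPart (p : CotangentBundle n M) (ξ : TangentSpace (cotangentModel n) p) :
    CotangentSpace n p.proj :=
  Prod.snd (α := Model n) (β := Model n →L[ℝ] ℝ) ξ -
    christoffelMap g p (Prod.fst (α := Model n) (β := Model n →L[ℝ] ℝ) ξ)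

theorem horizontalPart_horizontalLift (p : CotangentBundle n M)
    (X : TangentSpace (𝓡 n) p.proj) : horizontalPart p (horizontalLift g p X) = X := rfl

theorem horizontalPart_verticalLift (p : CotangentBundle n M)
    (θ : CotangentSpace n p.proj) : horizontalPart p (verticalLift p θ) = 0 := rfl

theorem verticalPart_horizontalLift (p : CotangentBundle n M)
    (X : TangentSpace (𝓡 n) p.proj) : verticalPart g p (horizontalLift g p X) = 0 :=
  sub_self (christoffelMap g p X)

theorem verticalPart_verticalLift (p : CotangentBundle n M)
    (θ : CotangentSpace n p.proj) : verticalPart g p (verticalLift p θ) = θ := by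
  have h : ∀ η : Model n →L[ℝ] ℝ, η - christoffelMap g p 0 = η := fun η ↦ by simp
  exact h θ

theorem horizontalLift_add_verticalLift (p : CotangentBundle n M)
    (ξ : TangentSpace (cotangentModel n) p) :
    horizontalLift g p (horizontalPart p ξ) + verticalLift p (verticalPart g p ξ) = ξ := by
  obtain ⟨X, η⟩ := ξ
  change ((X + 0, christoffelMap g p X + (η - christoffelMap g p X)) :
    Model n × (Model n →L[ℝ] ℝ)) = (X, η)
  simp

theorem horizontalLift_add (p : CotangentBundle n M) (X Y : TangentSpace (𝓡 n) p.proj) :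
    horizontalLift g p (X + Y) = horizontalLift g p X + horizontalLift g p Y := by
  have h : ∀ X Y : Model n, ((X + Y, christoffelMap g p (X + Y)) : Model n × (Model n →L[ℝ] ℝ)) =
    (X, christoffelMap g p X) + (Y, christoffelMap g p Y) := fun X Y ↦ by simp
  exact h X Y

theorem horizontalLift_smul (p : CotangentBundle n M) (r : ℝ) (X : TangentSpace (𝓡 n) p.proj) :
    horizontalLift g p (r • X) = r • horizontalLift g p X := by
  have h : ∀ X : Model n, ((r • X, christoffelMap g p (r • X)) : Model n × (Model n →L[ℝ] ℝ)) =
    r • (X, christoffelMap g p X) := fun X ↦ by simp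
  exact h X

theorem verticalLift_add (p : CotangentBundle n M) (θ η : CotangentSpace n p.proj) :
    verticalLift p (θ + η) = verticalLift p θ + verticalLift p η := by
  have h : ∀ θ η : Model n →L[ℝ] ℝ, ((0, θ + η) : Model n × (Model n →L[ℝ] ℝ)) =
    (0, θ) + (0, η) := fun θ η ↦ by simp
  exact h θ η

theorem verticalLift_smul (p : CotangentBundle n M) (r : ℝ) (θ : CotangentSpace n p.proj) :
    verticalLift p (r • θ) = r • verticalLift p θ := by
  have h : ∀ θ : Model n →L[ℝ] ℝ, ((0, r • θ) : Model n × (Model n →L[ℝ] ℝ)) =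
    r • (0, θ) := fun θ ↦ by simp
  exact h θ

theorem horizontalPart_add (p : CotangentBundle n M) (ξ ζ : TangentSpace (cotangentModel n) p) :
    horizontalPart p (ξ + ζ) = horizontalPart p ξ + horizontalPart p ζ := rfl

theorem horizontalPart_smul (p : CotangentBundle n M) (r : ℝ)
    (ξ : TangentSpace (cotangentModel n) p) :
    horizontalPart p (r • ξ) = r • horizontalPart p ξ := rfl

theorem verticalPart_add (p : CotangentBundle n M) (ξ ζ : TangentSpace (cotangentModel n) p) :
    verticalPart g p (ξ + ζ) = verticalPart g p ξ + verticalPart g p ζ := by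
  have h : ∀ ξ ζ : Model n × (Model n →L[ℝ] ℝ),
      (ξ + ζ).2 - christoffelMap g p (ξ + ζ).1 =
        (ξ.2 - christoffelMap g p ξ.1) + (ζ.2 - christoffelMap g p ζ.1) := fun ξ ζ ↦ by
    rw [Prod.fst_add, Prod.snd_add, map_add]; abel
  exact h ξ ζ

theorem verticalPart_smul (p : CotangentBundle n M) (r : ℝ)
    (ξ : TangentSpace (cotangentModel n) p) :
    verticalPart g p (r • ξ) = r • verticalPart g p ξ := by
  have h : ∀ ξ : Model n × (Model n →L[ℝ] ℝ),
      (r • ξ).2 - christoffelMap g p (r • ξ).1 =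
        r • (ξ.2 - christoffelMap g p ξ.1) := fun ξ ↦ by
    rw [Prod.smul_fst, Prod.smul_snd, map_smul, smul_sub]
  exact h ξ

/-! ### General natural lifts of the metric -/

/-- The coefficients `a₁, …, a₄, b₁, …, b₄` of a general natural tensor of type `(1,1)`: smooth
functions on `[0, ∞)`. -/
structure EndoCoeffs where
  (a₁ a₂ a₃ a₄ b₁ b₂ b₃ b₄ : ℝ → ℝ)
  smooth_a₁ : ContDiffOn ℝ ∞ a₁ (Ici 0)
  smooth_a₂ : ContDiffOn ℝ ∞ a₂ (Ici 0)
  smooth_a₃ : ContDiffOn ℝ ∞ a₃ (Ici 0)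
  smooth_a₄ : ContDiffOn ℝ ∞ a₄ (Ici 0)
  smooth_b₁ : ContDiffOn ℝ ∞ b₁ (Ici 0)
  smooth_b₂ : ContDiffOn ℝ ∞ b₂ (Ici 0)
  smooth_b₃ : ContDiffOn ℝ ∞ b₃ (Ici 0)
  smooth_b₄ : ContDiffOn ℝ ∞ b₄ (Ici 0)

/-- The sign convention `a₁, a₂, a₁ + 2tb₁, a₂ + 2tb₂ > 0` for all `t ≥ 0`. -/
structure EndoCoeffs.IsPositive (A : EndoCoeffs) : Prop where
  a₁_pos : ∀ t, 0 ≤ t → 0 < A.a₁ t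
  a₂_pos : ∀ t, 0 ≤ t → 0 < A.a₂ t
  ab₁_pos : ∀ t, 0 ≤ t → 0 < A.a₁ t + 2 * t * A.b₁ t
  ab₂_pos : ∀ t, 0 ≤ t → 0 < A.a₂ t + 2 * t * A.b₂ t

/-- The coefficients `c₁, c₂, c₃, d₁, d₂, d₃` of a natural metric on `T^*M`: smooth functions on
`[0, ∞)`. -/
structure MetricCoeffs where
  (c₁ c₂ c₃ d₁ d₂ d₃ : ℝ → ℝ)
  smooth_c₁ : ContDiffOn ℝ ∞ c₁ (Ici 0)
  smooth_c₂ : ContDiffOn ℝ ∞ c₂ (Ici 0)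
  smooth_c₃ : ContDiffOn ℝ ∞ c₃ (Ici 0)
  smooth_d₁ : ContDiffOn ℝ ∞ d₁ (Ici 0)
  smooth_d₂ : ContDiffOn ℝ ∞ d₂ (Ici 0)
  smooth_d₃ : ContDiffOn ℝ ∞ d₃ (Ici 0)

/-- The general natural tensor `J` of type `(1,1)` with coefficients `A`, evaluated on
`ξ = X^H + θ^V`:
`J X^H = a₁ (g_X)^V + b₁ p(X) p^V + a₄ X^H + b₄ p(X) (p^♯)^H`,
`J θ^V = a₃ θ^V + b₃ g⁻¹(p, θ) p^V - a₂ (θ^♯)^H - b₂ g⁻¹(p, θ) (p^♯)^H`. -/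
def naturalEndo (A : EndoCoeffs) (p : CotangentBundle n M)
    (ξ : TangentSpace (cotangentModel n) p) : TangentSpace (cotangentModel n) p :=
  let t := energy g p
  let X := horizontalPart p ξ
  let θ := verticalPart g p ξ
  (A.a₁ t • verticalLift p (flat g p.proj X)
      + (A.b₁ t * p.2 X) • verticalLift p p.2
      + A.a₄ t • horizontalLift g p X
      + (A.b₄ t * p.2 X) • horizontalLift g p (sharp g p.proj p.2))
    + (A.a₃ t • verticalLift p θ
      + (A.b₃ t * cometric g p.proj p.2 θ) • verticalLift p p.2
      - A.a₂ t • horizontalLift g p (sharp g p.proj θ)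
      - (A.b₂ t * cometric g p.proj p.2 θ) • horizontalLift g p (sharp g p.proj p.2))

theorem cometric_add_right (x : M) (θ η ζ : CotangentSpace n x) :
    cometric g x θ (η + ζ) = cometric g x θ η + cometric g x θ ζ := by
  unfold cometric
  rw [ContinuousLinearMap.map_add]
  exact ContinuousLinearMap.map_add _ _ _

theorem cometric_smul_right (x : M) (r : ℝ) (θ η : CotangentSpace n x) :
    cometric g x θ (r • η) = r * cometric g x θ η := by
  unfold cometric
  rw [ContinuousLinearMap.map_smul]
  exact ContinuousLinearMap.map_smul _ _ _

theorem naturalEndo_add (A : EndoCoeffs) (p : CotangentBundle n M)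
    (ξ ζ : TangentSpace (cotangentModel n) p) :
    naturalEndo g A p (ξ + ζ) = naturalEndo g A p ξ + naturalEndo g A p ζ := by
  simp only [naturalEndo, horizontalPart_add, verticalPart_add, ContinuousLinearMap.map_add,
    horizontalLift_add, verticalLift_add, cometric_add_right, smul_add, mul_add, add_smul]
  abel

theorem naturalEndo_smul (A : EndoCoeffs) (p : CotangentBundle n M) (r : ℝ)
    (ξ : TangentSpace (cotangentModel n) p) :
    naturalEndo g A p (r • ξ) = r • naturalEndo g A p ξ := by
  simp only [naturalEndo, horizontalPart_smul, verticalPart_smul, ContinuousLinearMap.map_smul,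
    horizontalLift_smul, verticalLift_smul, cometric_smul_right, smul_add, smul_sub, smul_smul,
    smul_eq_mul, mul_left_comm _ r, mul_comm r (A.a₁ _), mul_comm r (A.a₂ _),
    mul_comm r (A.a₃ _), mul_comm r (A.a₄ _)]

/-- The general natural metric `G` with coefficients `C`, evaluated on `ξ = X^H + θ^V` and
`ξ' = Y^H + η^V`:
`G(X^H, Y^H) = c₁ g(X, Y) + d₁ p(X) p(Y)`,
`G(θ^V, η^V) = c₂ g⁻¹(θ, η) + d₂ g⁻¹(p, θ) g⁻¹(p, η)`,
`G(X^H, θ^V) = G(θ^V, X^H) = c₃ θ(X) + d₃ p(X) g⁻¹(p, θ)`. -/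
def naturalMetric (C : MetricCoeffs) (p : CotangentBundle n M)
    (ξ ξ' : TangentSpace (cotangentModel n) p) : ℝ :=
  let t := energy g p
  let X := horizontalPart p ξ
  let Y := horizontalPart p ξ'
  let θ := verticalPart g p ξ
  let η := verticalPart g p ξ'
  (C.c₁ t * g.inner p.proj X Y + C.d₁ t * p.2 X * p.2 Y)
    + (C.c₂ t * cometric g p.proj θ η
        + C.d₂ t * cometric g p.proj p.2 θ * cometric g p.proj p.2 η)
    + (C.c₃ t * η X + C.d₃ t * p.2 X * cometric g p.proj p.2 η)
    + (C.c₃ t * θ Y + C.d₃ t * p.2 Y * cometric g p.proj p.2 θ)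

/-- `(T^*M, G, J)` is almost Hermitian: `J` is an almost complex structure, `G` is a Riemannian
metric (its symmetry is automatic), and `G(JX, JY) = G(X, Y)`. -/
structure IsAlmostHermitian (A : EndoCoeffs) (C : MetricCoeffs) : Prop where
  sq_eq_neg : ∀ (p : CotangentBundle n M) (ξ : TangentSpace (cotangentModel n) p),
    naturalEndo g A p (naturalEndo g A p ξ) = -ξ
  pos : ∀ (p : CotangentBundle n M) (ξ : TangentSpace (cotangentModel n) p), ξ ≠ 0 →
    0 < naturalMetric g C p ξ ξ
  compat : ∀ (p : CotangentBundle n M) (ξ ξ' : TangentSpace (cotangentModel n) p),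
    naturalMetric g C p (naturalEndo g A p ξ) (naturalEndo g A p ξ') = naturalMetric g C p ξ ξ'

theorem cometric_comm (x : M) (θ η : CotangentSpace n x) :
    cometric g x θ η = cometric g x η θ := by
  have h : ∀ θ η : CotangentSpace n x,
      cometric g x θ η = g.inner x (sharp g x θ) (sharp g x η) := fun θ η ↦
    congrArg (fun f : CotangentSpace n x ↦ f (sharp g x η)) (flat_sharp g x θ).symm
  rw [h, h, g.symm]

theorem naturalMetric_comm (C : MetricCoeffs) (p : CotangentBundle n M)
    (ξ ξ' : TangentSpace (cotangentModel n) p) :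
    naturalMetric g C p ξ ξ' = naturalMetric g C p ξ' ξ := by
  simp only [naturalMetric]
  rw [g.symm, cometric_comm g p.proj (verticalPart g p ξ) (verticalPart g p ξ')]
  ring

theorem naturalMetric_add_left (C : MetricCoeffs) (p : CotangentBundle n M)
    (ξ₁ ξ₂ ξ' : TangentSpace (cotangentModel n) p) :
    naturalMetric g C p (ξ₁ + ξ₂) ξ' = naturalMetric g C p ξ₁ ξ' + naturalMetric g C p ξ₂ ξ' := by
  have h1 : ∀ θ : CotangentSpace n p.proj,
      cometric g p.proj (verticalPart g p ξ₁ + verticalPart g p ξ₂) θ =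
        cometric g p.proj (verticalPart g p ξ₁) θ + cometric g p.proj (verticalPart g p ξ₂) θ :=
    fun θ ↦ rfl
  have h2 : (verticalPart g p ξ₁ + verticalPart g p ξ₂) (horizontalPart p ξ') =
      verticalPart g p ξ₁ (horizontalPart p ξ') + verticalPart g p ξ₂ (horizontalPart p ξ') := rfl
  have h3 : g.inner p.proj (horizontalPart p ξ₁ + horizontalPart p ξ₂) (horizontalPart p ξ') =
      g.inner p.proj (horizontalPart p ξ₁) (horizontalPart p ξ')
        + g.inner p.proj (horizontalPart p ξ₂) (horizontalPart p ξ') := by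
    rw [ContinuousLinearMap.map_add]; rfl
  have h4 : ∀ η : CotangentSpace n p.proj, η (horizontalPart p ξ₁ + horizontalPart p ξ₂) =
      η (horizontalPart p ξ₁) + η (horizontalPart p ξ₂) :=
    fun η ↦ ContinuousLinearMap.map_add η _ _
  simp only [naturalMetric, horizontalPart_add, verticalPart_add, h1, h2, h3, h4,
    cometric_add_right]
  ring

theorem naturalMetric_smul_left (C : MetricCoeffs) (p : CotangentBundle n M) (r : ℝ)
    (ξ ξ' : TangentSpace (cotangentModel n) p) :
    naturalMetric g C p (r • ξ) ξ' = r * naturalMetric g C p ξ ξ' := by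
  have h1 : ∀ θ : CotangentSpace n p.proj,
      cometric g p.proj (r • verticalPart g p ξ) θ =
        r * cometric g p.proj (verticalPart g p ξ) θ := fun θ ↦ rfl
  have h2 : (r • verticalPart g p ξ) (horizontalPart p ξ') =
      r * verticalPart g p ξ (horizontalPart p ξ') := rfl
  have h3 : g.inner p.proj (r • horizontalPart p ξ) (horizontalPart p ξ') =
      r * g.inner p.proj (horizontalPart p ξ) (horizontalPart p ξ') := by
    rw [ContinuousLinearMap.map_smul]; rfl
  have h4 : ∀ η : CotangentSpace n p.proj, η (r • horizontalPart p ξ) =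
      r * η (horizontalPart p ξ) := fun η ↦ ContinuousLinearMap.map_smul η _ _
  simp only [naturalMetric, horizontalPart_smul, verticalPart_smul, h1, h2, h3, h4,
    cometric_smul_right]
  ring

theorem naturalMetric_add_right (C : MetricCoeffs) (p : CotangentBundle n M)
    (ξ ξ₁ ξ₂ : TangentSpace (cotangentModel n) p) :
    naturalMetric g C p ξ (ξ₁ + ξ₂) = naturalMetric g C p ξ ξ₁ + naturalMetric g C p ξ ξ₂ := by
  simp only [naturalMetric_comm g C p ξ, naturalMetric_add_left]

theorem naturalMetric_smul_right (C : MetricCoeffs) (p : CotangentBundle n M) (r : ℝ)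
    (ξ ξ' : TangentSpace (cotangentModel n) p) :
    naturalMetric g C p ξ (r • ξ') = r * naturalMetric g C p ξ ξ' := by
  simp only [naturalMetric_comm g C p ξ, naturalMetric_smul_left]

/-- The map `Ω_p(ξ, ξ') = G(ξ, J ξ')`. -/
def fundamentalBilin (A : EndoCoeffs) (C : MetricCoeffs) (p : CotangentBundle n M)
    (ξ ξ' : TangentSpace (cotangentModel n) p) : ℝ :=
  naturalMetric g C p ξ (naturalEndo g A p ξ')

variable {g} in
theorem IsAlmostHermitian.fundamentalBilin_self {A : EndoCoeffs} {C : MetricCoeffs}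
    (h : IsAlmostHermitian g A C) (p : CotangentBundle n M)
    (ξ : TangentSpace (cotangentModel n) p) : fundamentalBilin g A C p ξ ξ = 0 := by
  have h1 := h.compat p ξ (naturalEndo g A p ξ)
  rw [h.sq_eq_neg, naturalMetric_comm, ← neg_one_smul ℝ ξ, naturalMetric_smul_left] at h1
  unfold fundamentalBilin
  linarith

theorem continuous_of_bilin {V : Type*} [NormedAddCommGroup V] [NormedSpace ℝ V]
    [FiniteDimensional ℝ V] (B : V → V → ℝ)
    (h1 : ∀ x y z, B (x + y) z = B x z + B y z) (h2 : ∀ (r : ℝ) x z, B (r • x) z = r • B x z)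
    (h3 : ∀ x y z, B x (y + z) = B x y + B x z) (h4 : ∀ (r : ℝ) x z, B x (r • z) = r • B x z) :
    Continuous fun v : Fin 2 → V ↦ B (v 0) (v 1) := by
  let L : V →ₗ[ℝ] (V →L[ℝ] ℝ) :=
    (LinearMap.toContinuousLinearMap (𝕜 := ℝ) (E := V) (F' := ℝ)).toLinearMap ∘ₗ
      LinearMap.mk₂ ℝ B h1 h2 h3 h4
  have hL : Continuous L := LinearMap.continuous_of_finiteDimensional L
  exact (hL.comp (continuous_apply 0)).clm_apply (continuous_apply 1)

theorem continuous_fundamentalBilin (A : EndoCoeffs) (C : MetricCoeffs)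
    (p : CotangentBundle n M) :
    Continuous fun v : Fin 2 → TangentSpace (cotangentModel n) p ↦
      fundamentalBilin g A C p (v 0) (v 1) := by
  refine continuous_of_bilin (V := Model n × (Model n →L[ℝ] ℝ)) (fundamentalBilin g A C p) ?_ ?_ ?_ ?_
  · exact fun x y z ↦ naturalMetric_add_left g C p x y _
  · exact fun r x z ↦ naturalMetric_smul_left g C p r x _
  · intro x y z
    exact (congrArg _ (naturalEndo_add g A p y z)).trans (naturalMetric_add_right g C p x _ _)
  · intro r x z
    exact (congrArg _ (naturalEndo_smul g A p r z)).trans (naturalMetric_smul_right g C p r x _)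

variable {g} in
/-- The fundamental `2`-form `Ω(X, Y) = G(X, JY)` of an almost Hermitian structure `(G, J)`. -/
def fundamentalForm {A : EndoCoeffs} {C : MetricCoeffs} (h : IsAlmostHermitian g A C) :
    DiffForm (cotangentModel n) (CotangentBundle n M) 2 := fun p ↦
  { toFun := fun v ↦ fundamentalBilin g A C p (v 0) (v 1)
    map_update_add' := by
      intro _ v i x y
      fin_cases i <;>
        simp [fundamentalBilin, naturalMetric_add_left, naturalMetric_add_right, naturalEndo_add]
    map_update_smul' := by
      intro _ v i r x
      fin_cases i <;>
        simp [fundamentalBilin, naturalMetric_smul_left, naturalMetric_smul_right,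
          naturalEndo_smul]
    map_eq_zero_of_eq' := by
      intro v i j hv hij
      have h01 : v 0 = v 1 := by
        fin_cases i <;> fin_cases j <;> simp_all
      rw [h01]
      exact h.fundamentalBilin_self p (v 1)
    cont := continuous_fundamentalBilin g A C p }

/-- The smooth functions `lam`, `mu` on `[0, ∞)` are the proportionality factors of the
coefficients: `c_i = λ a_i` and `c_i + 2t d_i = (λ + 2tμ) (a_i + 2t b_i)` for `i = 1, 2, 3`, with
`λ > 0` and `λ + 2tμ > 0`. -/
structure IsProportionality (A : EndoCoeffs) (C : MetricCoeffs) (lam mu : ℝ → ℝ) : Prop where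
  smooth_lam : ContDiffOn ℝ ∞ lam (Ici 0)
  smooth_mu : ContDiffOn ℝ ∞ mu (Ici 0)
  lam_pos : ∀ t, 0 ≤ t → 0 < lam t
  lam_mu_pos : ∀ t, 0 ≤ t → 0 < lam t + 2 * t * mu t
  c₁_eq : ∀ t, 0 ≤ t → C.c₁ t = lam t * A.a₁ t
  c₂_eq : ∀ t, 0 ≤ t → C.c₂ t = lam t * A.a₂ t
  c₃_eq : ∀ t, 0 ≤ t → C.c₃ t = lam t * A.a₃ t
  cd₁_eq : ∀ t, 0 ≤ t →
    C.c₁ t + 2 * t * C.d₁ t = (lam t + 2 * t * mu t) * (A.a₁ t + 2 * t * A.b₁ t)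
  cd₂_eq : ∀ t, 0 ≤ t →
    C.c₂ t + 2 * t * C.d₂ t = (lam t + 2 * t * mu t) * (A.a₂ t + 2 * t * A.b₂ t)
  cd₃_eq : ∀ t, 0 ≤ t →
    C.c₃ t + 2 * t * C.d₃ t = (lam t + 2 * t * mu t) * (A.a₃ t + 2 * t * A.b₃ t)

end NaturalLift

end

noncomputable section

namespace NaturalLift

variable {n : ℕ} {M : Type*} [TopologicalSpace M] [ChartedSpace (Model n) M]
  [IsManifold (𝓡 n) ∞ M]

variable (g : Metric n M)

theorem sharp_flat (x : M) (X : TangentSpace (𝓡 n) x) : sharp g x (flat g x X) = X := by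
  by_contra hne
  have h1 := g.pos x (sharp g x (flat g x X) - X) (sub_ne_zero.2 hne)
  have h2 : flat g x (sharp g x (flat g x X) - X) = 0 := by
    rw [ContinuousLinearMap.map_sub, flat_sharp, sub_self]
  have h3 : g.inner x (sharp g x (flat g x X) - X) = 0 := h2
  rw [h3] at h1
  exact lt_irrefl _ h1

theorem cometric_flat (x : M) (θ : CotangentSpace n x) (X : TangentSpace (𝓡 n) x) :
    cometric g x θ (flat g x X) = θ X := by
  rw [cometric, sharp_flat]

theorem cometric_self_pos (x : M) (θ : CotangentSpace n x) (h : θ ≠ 0) :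
    0 < cometric g x θ θ := by
  have h1 : sharp g x θ ≠ 0 := fun h0 ↦ h (by
    rw [← flat_sharp g x θ, h0, ContinuousLinearMap.map_zero])
  have h2 := g.pos x _ h1
  have h3 : g.inner x (sharp g x θ) = θ := flat_sharp g x θ
  rwa [h3] at h2

theorem cometric_smul_left (x : M) (r : ℝ) (θ η : CotangentSpace n x) :
    cometric g x (r • θ) η = r * cometric g x θ η := rfl

theorem energy_nonneg (p : CotangentBundle n M) : 0 ≤ energy g p := by
  by_cases h : p.2 = 0
  · have : cometric g p.proj p.2 p.2 = 0 := by rw [h]; rfl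
    rw [energy, this, mul_zero]
  · have := cometric_self_pos g p.proj p.2 h
    rw [energy]; positivity

theorem apply_sharp_self (p : CotangentBundle n M) :
    p.2 (sharp g p.proj p.2) = 2 * energy g p := by
  rw [energy, cometric]; ring

theorem eq_zero_of_smul_eq_zero {V : Type*} [AddCommGroup V] [Module ℝ V] {r : ℝ} {v : V}
    (h : r • v = 0) (hv : v ≠ 0) : r = 0 :=
  (smul_eq_zero.1 h).resolve_right hv

theorem smul_combination {V : Type*} [AddCommGroup V] [Module ℝ V] {s k : ℝ} {v w x y : V}
    (h₁ : s • w = k • v) (h₂ : s • y = k • x) (a b c d : ℝ) :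
    a • v + (b * s) • w + c • x + (d * s) • y = (a + k * b) • v + (c + k * d) • x := by
  rw [mul_smul, mul_smul, h₁, h₂]
  module

theorem smul_combination_sub {V : Type*} [AddCommGroup V] [Module ℝ V] {s k : ℝ} {v w x y : V}
    (h₁ : s • w = k • v) (h₂ : s • y = k • x) (a b c d : ℝ) :
    a • v + (b * s) • w - c • x - (d * s) • y = (a + k * b) • v - (c + k * d) • x := by
  rw [mul_smul, mul_smul, h₁, h₂]
  module

theorem verticalPart_zero (p : CotangentBundle n M) : verticalPart g p 0 = 0 := by
  have := verticalPart_smul g p 0 0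
  rwa [zero_smul, zero_smul] at this

section Relations

variable (A : EndoCoeffs) (C : MetricCoeffs) (p : CotangentBundle n M)
  (X : TangentSpace (𝓡 n) p.proj)

theorem verticalLift_zero : verticalLift p (0 : CotangentSpace n p.proj) = 0 := rfl

theorem horizontalLift_zero : horizontalLift g p (0 : TangentSpace (𝓡 n) p.proj) = 0 := by
  have := horizontalLift_smul g p 0 0
  rwa [zero_smul, zero_smul] at this

variable {p X} {k : ℝ} (hk : p.2 X • sharp g p.proj p.2 = k • X)
include hk

theorem smul_eq_smul_flat : p.2 X • p.2 = k • flat g p.proj X := by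
  have := congrArg (flat g p.proj) hk
  rwa [ContinuousLinearMap.map_smul, ContinuousLinearMap.map_smul, flat_sharp] at this

theorem smul_verticalLift_eq :
    p.2 X • verticalLift p p.2 = k • verticalLift p (flat g p.proj X) := by
  rw [← verticalLift_smul, ← verticalLift_smul, smul_eq_smul_flat g hk]

theorem smul_horizontalLift_eq :
    p.2 X • horizontalLift g p (sharp g p.proj p.2) = k • horizontalLift g p X := by
  rw [← horizontalLift_smul, ← horizontalLift_smul, hk]

theorem naturalEndo_horizontalLift_of_smul_eq :
    naturalEndo g A p (horizontalLift g p X) =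
      (A.a₁ (energy g p) + k * A.b₁ (energy g p)) • verticalLift p (flat g p.proj X) +
      (A.a₄ (energy g p) + k * A.b₄ (energy g p)) • horizontalLift g p X := by
  have h0 : cometric g p.proj p.2 0 = 0 := by
    rw [cometric, ContinuousLinearMap.map_zero]; exact ContinuousLinearMap.map_zero _
  simp only [naturalEndo, horizontalPart_horizontalLift, verticalPart_horizontalLift, h0,
    ContinuousLinearMap.map_zero, verticalLift_zero, horizontalLift_zero, smul_zero, mul_zero,
    zero_smul, add_zero, sub_zero]
  exact smul_combination (smul_verticalLift_eq g hk) (smul_horizontalLift_eq g hk) _ _ _ _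

theorem naturalEndo_verticalLift_of_smul_eq :
    naturalEndo g A p (verticalLift p (flat g p.proj X)) =
      (A.a₃ (energy g p) + k * A.b₃ (energy g p)) • verticalLift p (flat g p.proj X) -
      (A.a₂ (energy g p) + k * A.b₂ (energy g p)) • horizontalLift g p X := by
  have h0 : p.2 0 = 0 := ContinuousLinearMap.map_zero _
  simp only [naturalEndo, horizontalPart_verticalLift, verticalPart_verticalLift, h0,
    ContinuousLinearMap.map_zero, verticalLift_zero, horizontalLift_zero, smul_zero, mul_zero,
    zero_smul, zero_add, cometric_flat, sharp_flat]
  exact smul_combination_sub (smul_verticalLift_eq g hk) (smul_horizontalLift_eq g hk) _ _ _ _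

theorem apply_mul_apply : p.2 X * p.2 X = k * g.inner p.proj X X :=
  congrArg (fun f : CotangentSpace n p.proj ↦ f X) (smul_eq_smul_flat g hk)

theorem naturalMetric_horizontalLift_self :
    naturalMetric g C p (horizontalLift g p X) (horizontalLift g p X) =
      (C.c₁ (energy g p) + k * C.d₁ (energy g p)) * g.inner p.proj X X := by
  have h0 : ∀ θ, cometric g p.proj θ 0 = 0 := fun θ ↦ by
    rw [cometric, ContinuousLinearMap.map_zero]; exact ContinuousLinearMap.map_zero _
  have h1 : (0 : CotangentSpace n p.proj) X = 0 := rfl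
  simp only [naturalMetric, horizontalPart_horizontalLift, verticalPart_horizontalLift, h0, h1]
  linear_combination C.d₁ (energy g p) * apply_mul_apply g hk

theorem naturalMetric_verticalLift_self :
    naturalMetric g C p (verticalLift p (flat g p.proj X)) (verticalLift p (flat g p.proj X)) =
      (C.c₂ (energy g p) + k * C.d₂ (energy g p)) * g.inner p.proj X X := by
  have h0 : ∀ θ : CotangentSpace n p.proj, θ 0 = 0 := fun θ ↦ ContinuousLinearMap.map_zero _
  have h2 : flat g p.proj X X = g.inner p.proj X X := rfl
  simp only [naturalMetric, horizontalPart_verticalLift, verticalPart_verticalLift, h0,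
    cometric_flat, h2]
  linear_combination C.d₂ (energy g p) * apply_mul_apply g hk

theorem naturalMetric_horizontalLift_verticalLift :
    naturalMetric g C p (horizontalLift g p X) (verticalLift p (flat g p.proj X)) =
      (C.c₃ (energy g p) + k * C.d₃ (energy g p)) * g.inner p.proj X X := by
  have h0 : ∀ θ : CotangentSpace n p.proj, θ 0 = 0 := fun θ ↦ ContinuousLinearMap.map_zero _
  have h2 : flat g p.proj X X = g.inner p.proj X X := rfl
  have h3 : ∀ η, cometric g p.proj 0 η = 0 := fun θ ↦ rfl
  have h4 : ∀ η, cometric g p.proj η 0 = 0 := fun θ ↦ by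
    rw [cometric_comm]; rfl
  simp only [naturalMetric, horizontalPart_verticalLift, verticalPart_verticalLift, h0,
    horizontalPart_horizontalLift, verticalPart_horizontalLift,
    cometric_flat, h2, h3, h4]
  linear_combination C.d₃ (energy g p) * apply_mul_apply g hk

end Relations

/-- The relations between the coefficients of an almost Hermitian structure on the `J`-invariant
plane spanned by `X^H` and `(g_X)^V`. -/
structure CoeffRelations (a₁ a₂ a₃ a₄ c₁ c₂ c₃ : ℝ) : Prop where
  c₁_pos : 0 < c₁
  a₄_eq : a₄ = -a₃
  det_eq : a₁ * a₂ = 1 + a₃ ^ 2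
  c₂_mul : c₂ * a₁ = c₁ * a₂
  c₃_mul : c₃ * a₁ = c₁ * a₃

variable {g} in
set_option maxHeartbeats 1000000 in
theorem IsAlmostHermitian.coeffRelations {A : EndoCoeffs} {C : MetricCoeffs}
    (h : IsAlmostHermitian g A C) {p : CotangentBundle n M} {X : TangentSpace (𝓡 n) p.proj}
    (hX : X ≠ 0) {k : ℝ} (hk : p.2 X • sharp g p.proj p.2 = k • X)
    (hpos : 0 < A.a₁ (energy g p) + k * A.b₁ (energy g p)) :
    CoeffRelations (A.a₁ (energy g p) + k * A.b₁ (energy g p))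
      (A.a₂ (energy g p) + k * A.b₂ (energy g p)) (A.a₃ (energy g p) + k * A.b₃ (energy g p))
      (A.a₄ (energy g p) + k * A.b₄ (energy g p)) (C.c₁ (energy g p) + k * C.d₁ (energy g p))
      (C.c₂ (energy g p) + k * C.d₂ (energy g p)) (C.c₃ (energy g p) + k * C.d₃ (energy g p)) := by
  have hJH := naturalEndo_horizontalLift_of_smul_eq g A hk
  have hJV := naturalEndo_verticalLift_of_smul_eq g A hk
  have hHH := naturalMetric_horizontalLift_self g C hk
  have hVV := naturalMetric_verticalLift_self g C hk
  have hHV := naturalMetric_horizontalLift_verticalLift g C hk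
  have hN := g.pos p.proj X hX
  generalize A.a₁ (energy g p) + k * A.b₁ (energy g p) = a₁ at *
  generalize A.a₂ (energy g p) + k * A.b₂ (energy g p) = a₂ at *
  generalize A.a₃ (energy g p) + k * A.b₃ (energy g p) = a₃ at *
  generalize A.a₄ (energy g p) + k * A.b₄ (energy g p) = a₄ at *
  generalize C.c₁ (energy g p) + k * C.d₁ (energy g p) = c₁ at *
  generalize C.c₂ (energy g p) + k * C.d₂ (energy g p) = c₂ at *
  generalize C.c₃ (energy g p) + k * C.d₃ (energy g p) = c₃ at *
  have hH0 : horizontalLift g p X ≠ 0 := fun h0 ↦ hX (by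
    rw [← horizontalPart_horizontalLift g p X, h0]; rfl)
  have hV0 : flat g p.proj X ≠ 0 := fun h0 ↦ hX (by
    rw [← sharp_flat g p.proj X, h0, ContinuousLinearMap.map_zero])
  have hsq : (a₁ * a₃ + a₄ * a₁) • verticalLift p (flat g p.proj X) +
      (a₄ * a₄ - a₁ * a₂ + 1) • horizontalLift g p X = 0 := by
    have h1 := h.sq_eq_neg p (horizontalLift g p X)
    rw [hJH, naturalEndo_add, naturalEndo_smul, naturalEndo_smul, hJH, hJV,
      ← add_eq_zero_iff_eq_neg] at h1
    rw [← h1]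
    module
  have e1 : a₁ * (a₃ + a₄) = 0 := by
    have h1 := congrArg (verticalPart g p) hsq
    rw [verticalPart_add, verticalPart_smul, verticalPart_smul, verticalPart_horizontalLift,
      verticalPart_verticalLift, smul_zero, add_zero, verticalPart_zero] at h1
    have := eq_zero_of_smul_eq_zero (V := Model n →L[ℝ] ℝ) h1 hV0
    linarith
  have ha₄ : a₄ = -a₃ := by
    have := (mul_eq_zero.1 e1).resolve_left hpos.ne'
    linarith
  have e2 : a₁ * a₂ = 1 + a₄ ^ 2 := by
    have h1 := congrArg (horizontalPart p) hsq
    rw [horizontalPart_add, horizontalPart_smul, horizontalPart_smul, horizontalPart_horizontalLift,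
      horizontalPart_verticalLift, smul_zero, zero_add] at h1
    have := eq_zero_of_smul_eq_zero (V := Model n) h1 hX
    linarith
  have hc₁ : 0 < c₁ := by
    have := h.pos p _ hH0
    rw [hHH] at this
    exact (pos_iff_pos_of_mul_pos this).2 hN
  have e3 : c₃ * a₁ + c₁ * a₄ = 0 := by
    have h1 := h.fundamentalBilin_self p (horizontalLift g p X)
    rw [fundamentalBilin, hJH, naturalMetric_add_right, naturalMetric_smul_right,
      naturalMetric_smul_right, hHH, hHV] at h1
    have : (c₃ * a₁ + c₁ * a₄) * g.inner p.proj X X = 0 := by linarith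
    exact (mul_eq_zero.1 this).resolve_right hN.ne'
  have e4 : a₁ ^ 2 * c₂ + 2 * a₁ * a₄ * c₃ + a₄ ^ 2 * c₁ = c₁ := by
    have h1 := h.compat p (horizontalLift g p X) (horizontalLift g p X)
    rw [hJH] at h1
    simp only [naturalMetric_add_right, naturalMetric_smul_right, naturalMetric_add_left,
      naturalMetric_smul_left] at h1
    rw [naturalMetric_comm g C p (verticalLift p _) (horizontalLift g p X), hHH, hHV, hVV] at h1
    refine mul_right_cancel₀ hN.ne' ?_
    linear_combination h1
  subst ha₄
  refine ⟨hc₁, rfl, by linarith, ?_, by linarith⟩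
  refine mul_left_cancel₀ hpos.ne' ?_
  linear_combination e4 + 2 * a₃ * e3 - c₁ * e2

theorem exists_energy_eq (hn : 2 ≤ n) (x : M) {t : ℝ} (ht : 0 ≤ t) :
    ∃ p : CotangentBundle n M, p.proj = x ∧ energy g p = t := by
  let u : TangentSpace (𝓡 n) x := e (⟨0, by omega⟩ : Fin n)
  have hu : u ≠ 0 := by
    intro h0
    have h1 : (e (⟨0, by omega⟩ : Fin n) : Model n) = 0 := h0
    simp [e] at h1
  have hN : 0 < g.inner x u u := g.pos x u hu
  have hN' : flat g x u u = g.inner x u u := rfl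
  refine ⟨⟨x, √(2 * t / g.inner x u u) • flat g x u⟩, rfl, ?_⟩
  simp only [energy]
  rw [cometric_smul_right, cometric_smul_left, cometric_flat, hN', ← mul_assoc,
    ← mul_assoc, mul_assoc (1 / 2 : ℝ), Real.mul_self_sqrt (by positivity)]
  field_simp

omit [IsManifold (𝓡 n) ∞ M] in
theorem exists_ne_zero_apply_eq_zero (hn : 2 ≤ n) {x : M} (θ : CotangentSpace n x) :
    ∃ X : TangentSpace (𝓡 n) x, X ≠ 0 ∧ θ X = 0 := by
  have key : ∀ f : Model n →L[ℝ] ℝ, ∃ v : Model n, v ≠ 0 ∧ f v = 0 := by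
    intro f
    have h1 : LinearMap.ker (f : Model n →ₗ[ℝ] ℝ) ≠ ⊥ := by
      apply LinearMap.ker_ne_bot_of_finrank_lt
      rw [finrank_euclideanSpace_fin, Module.finrank_self]
      omega
    obtain ⟨v, hv, hv0⟩ := (Submodule.ne_bot_iff _).1 h1
    exact ⟨v, hv0, hv⟩
  exact key θ

theorem eq_zero_of_energy_eq_zero {p : CotangentBundle n M} (h : energy g p = 0) : p.2 = 0 := by
  by_contra hp
  have h1 := cometric_self_pos g p.proj p.2 hp
  rw [energy] at h
  linarith

variable {g} in
theorem IsAlmostHermitian.coeffRelations_orthogonal (hn : 2 ≤ n) [Nonempty M] {A : EndoCoeffs}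
    {C : MetricCoeffs} (hA : A.IsPositive) (h : IsAlmostHermitian g A C) {t : ℝ} (ht : 0 ≤ t) :
    CoeffRelations (A.a₁ t) (A.a₂ t) (A.a₃ t) (A.a₄ t) (C.c₁ t) (C.c₂ t) (C.c₃ t) := by
  obtain ⟨p, -, rfl⟩ := exists_energy_eq g hn (Classical.arbitrary M) ht
  obtain ⟨X, hX, hpX⟩ := exists_ne_zero_apply_eq_zero hn p.2
  have hk : p.2 X • sharp g p.proj p.2 = (0 : ℝ) • X := by rw [hpX, zero_smul, zero_smul]
  have h1 := h.coeffRelations hX hk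
  simp only [zero_mul, add_zero] at h1
  exact h1 (hA.a₁_pos _ ht)

variable {g} in
theorem IsAlmostHermitian.coeffRelations_radial (hn : 2 ≤ n) [Nonempty M] {A : EndoCoeffs}
    {C : MetricCoeffs} (hA : A.IsPositive) (h : IsAlmostHermitian g A C) {t : ℝ} (ht : 0 ≤ t) :
    CoeffRelations (A.a₁ t + 2 * t * A.b₁ t) (A.a₂ t + 2 * t * A.b₂ t) (A.a₃ t + 2 * t * A.b₃ t)
      (A.a₄ t + 2 * t * A.b₄ t) (C.c₁ t + 2 * t * C.d₁ t) (C.c₂ t + 2 * t * C.d₂ t)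
      (C.c₃ t + 2 * t * C.d₃ t) := by
  rcases ht.eq_or_lt with rfl | hpos
  · simpa using h.coeffRelations_orthogonal hn hA le_rfl
  obtain ⟨p, -, rfl⟩ := exists_energy_eq g hn (Classical.arbitrary M) ht
  have hX : sharp g p.proj p.2 ≠ 0 := by
    intro h0
    have h1 := apply_sharp_self g p
    rw [h0, ContinuousLinearMap.map_zero] at h1
    linarith
  refine h.coeffRelations hX ?_ (hA.ab₁_pos _ ht)
  rw [apply_sharp_self]

variable {g} in
theorem IsAlmostHermitian.exists_isProportionality (hn : 2 ≤ n) [Nonempty M] {A : EndoCoeffs}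
    {C : MetricCoeffs} (hA : A.IsPositive) (h : IsAlmostHermitian g A C) :
    ∃ lam mu : ℝ → ℝ, IsProportionality A C lam mu := by
  have hid : ContDiffOn ℝ ∞ (fun t : ℝ ↦ 2 * t) (Ici 0) := by fun_prop
  have hab : ∀ t, 0 ≤ t → A.a₁ t ≠ 0 ∧ A.a₁ t + 2 * t * A.b₁ t ≠ 0 := fun t ht ↦
    ⟨(hA.a₁_pos t ht).ne', (hA.ab₁_pos t ht).ne'⟩
  have hsum : ∀ t, 0 ≤ t → C.c₁ t / A.a₁ t + 2 * t *
      ((A.a₁ t * C.d₁ t - C.c₁ t * A.b₁ t) / (A.a₁ t * (A.a₁ t + 2 * t * A.b₁ t))) =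
      (C.c₁ t + 2 * t * C.d₁ t) / (A.a₁ t + 2 * t * A.b₁ t) := fun t ht ↦ by
    obtain ⟨h1, h2⟩ := hab t ht
    rw [div_add' _ _ _ h1, div_eq_div_iff h1 h2]
    field_simp
    ring
  refine ⟨fun t ↦ C.c₁ t / A.a₁ t, fun t ↦ (A.a₁ t * C.d₁ t - C.c₁ t * A.b₁ t) /
      (A.a₁ t * (A.a₁ t + 2 * t * A.b₁ t)),
    C.smooth_c₁.div A.smooth_a₁ fun t ht ↦ (hab t ht).1,
    ((A.smooth_a₁.mul C.smooth_d₁).sub (C.smooth_c₁.mul A.smooth_b₁)).div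
      (A.smooth_a₁.mul (A.smooth_a₁.add (hid.mul A.smooth_b₁)))
      fun t ht ↦ mul_ne_zero (hab t ht).1 (hab t ht).2, ?_, ?_, ?_, ?_, ?_, ?_, ?_, ?_⟩
  · exact fun t ht ↦ div_pos (h.coeffRelations_orthogonal hn hA ht).c₁_pos (hA.a₁_pos t ht)
  · intro t ht
    simp only [hsum t ht]
    exact div_pos (h.coeffRelations_radial hn hA ht).c₁_pos (hA.ab₁_pos t ht)
  · exact fun t ht ↦ (div_mul_cancel₀ _ (hab t ht).1).symm
  · intro t ht
    rw [div_mul_eq_mul_div, eq_div_iff (hab t ht).1]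
    exact (h.coeffRelations_orthogonal hn hA ht).c₂_mul
  · intro t ht
    rw [div_mul_eq_mul_div, eq_div_iff (hab t ht).1]
    exact (h.coeffRelations_orthogonal hn hA ht).c₃_mul
  · intro t ht
    simp only [hsum t ht]
    exact (div_mul_cancel₀ _ (hab t ht).2).symm
  · intro t ht
    simp only [hsum t ht]
    rw [div_mul_eq_mul_div, eq_div_iff (hab t ht).2]
    exact (h.coeffRelations_radial hn hA ht).c₂_mul
  · intro t ht
    simp only [hsum t ht]
    rw [div_mul_eq_mul_div, eq_div_iff (hab t ht).2]
    exact (h.coeffRelations_radial hn hA ht).c₃_mul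

/-! ### The fundamental form in terms of the proportionality factors -/

theorem horizontalPart_sub (p : CotangentBundle n M) (ξ ζ : TangentSpace (cotangentModel n) p) :
    horizontalPart p (ξ - ζ) = horizontalPart p ξ - horizontalPart p ζ := rfl

theorem verticalPart_sub (p : CotangentBundle n M) (ξ ζ : TangentSpace (cotangentModel n) p) :
    verticalPart g p (ξ - ζ) = verticalPart g p ξ - verticalPart g p ζ := by
  rw [eq_sub_iff_add_eq, ← verticalPart_add, sub_add_cancel]

theorem apply_horizontalPart_naturalEndo (A : EndoCoeffs) (p : CotangentBundle n M)
    (ξ : TangentSpace (cotangentModel n) p) (θ : CotangentSpace n p.proj) :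
    θ (horizontalPart p (naturalEndo g A p ξ)) =
      A.a₄ (energy g p) * θ (horizontalPart p ξ) +
      A.b₄ (energy g p) * p.2 (horizontalPart p ξ) * cometric g p.proj θ p.2 -
      A.a₂ (energy g p) * cometric g p.proj θ (verticalPart g p ξ) -
      A.b₂ (energy g p) * cometric g p.proj p.2 (verticalPart g p ξ) *
        cometric g p.proj θ p.2 := by
  have h : horizontalPart p (naturalEndo g A p ξ) =
      A.a₄ (energy g p) • horizontalPart p ξ +
      (A.b₄ (energy g p) * p.2 (horizontalPart p ξ)) • sharp g p.proj p.2 -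
      A.a₂ (energy g p) • sharp g p.proj (verticalPart g p ξ) -
      (A.b₂ (energy g p) * cometric g p.proj p.2 (verticalPart g p ξ)) •
        sharp g p.proj p.2 := by
    simp only [naturalEndo, horizontalPart_add, horizontalPart_sub, horizontalPart_smul,
      horizontalPart_horizontalLift, horizontalPart_verticalLift, smul_zero, zero_add]
    abel
  rw [h, ContinuousLinearMap.map_sub, ContinuousLinearMap.map_sub, ContinuousLinearMap.map_add,
    ContinuousLinearMap.map_smul, ContinuousLinearMap.map_smul, ContinuousLinearMap.map_smul,
    ContinuousLinearMap.map_smul]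
  rfl

theorem verticalPart_naturalEndo_apply (A : EndoCoeffs) (p : CotangentBundle n M)
    (ξ : TangentSpace (cotangentModel n) p) (X : TangentSpace (𝓡 n) p.proj) :
    verticalPart g p (naturalEndo g A p ξ) X =
      A.a₁ (energy g p) * g.inner p.proj (horizontalPart p ξ) X +
      A.b₁ (energy g p) * p.2 (horizontalPart p ξ) * p.2 X +
      A.a₃ (energy g p) * verticalPart g p ξ X +
      A.b₃ (energy g p) * cometric g p.proj p.2 (verticalPart g p ξ) * p.2 X := by
  have h : verticalPart g p (naturalEndo g A p ξ) =
      A.a₁ (energy g p) • flat g p.proj (horizontalPart p ξ) +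
      (A.b₁ (energy g p) * p.2 (horizontalPart p ξ)) • p.2 +
      A.a₃ (energy g p) • verticalPart g p ξ +
      (A.b₃ (energy g p) * cometric g p.proj p.2 (verticalPart g p ξ)) • p.2 := by
    simp only [naturalEndo, verticalPart_add, verticalPart_sub, verticalPart_smul,
      verticalPart_horizontalLift, verticalPart_verticalLift, smul_zero, add_zero, sub_zero]
    abel
  rw [h]
  rfl

theorem radial_coeff_identities {a₁ a₂ a₃ a₄ b₁ b₂ b₃ b₄ c₁ c₂ c₃ d₁ d₂ d₃ l m t : ℝ} (ht : t ≠ 0)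
    (r₁ : a₄ = -a₃) (r₂ : a₁ * a₂ = 1 + a₃ ^ 2) (s₁ : a₄ + 2 * t * b₄ = -(a₃ + 2 * t * b₃))
    (s₂ : (a₁ + 2 * t * b₁) * (a₂ + 2 * t * b₂) = 1 + (a₃ + 2 * t * b₃) ^ 2)
    (q₁ : c₁ = l * a₁) (q₂ : c₂ = l * a₂) (q₃ : c₃ = l * a₃)
    (q₄ : c₁ + 2 * t * d₁ = (l + 2 * t * m) * (a₁ + 2 * t * b₁))
    (q₅ : c₂ + 2 * t * d₂ = (l + 2 * t * m) * (a₂ + 2 * t * b₂))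
    (q₆ : c₃ + 2 * t * d₃ = (l + 2 * t * m) * (a₃ + 2 * t * b₃)) :
    c₁ * b₄ + d₁ * (a₄ + 2 * t * b₄) + c₃ * b₁ + d₃ * (a₁ + 2 * t * b₁) = 0 ∧
    c₂ * b₃ + d₂ * (a₃ + 2 * t * b₃) - c₃ * b₂ - d₃ * (a₂ + 2 * t * b₂) = 0 ∧
    -c₁ * b₂ - d₁ * (a₂ + 2 * t * b₂) + c₃ * b₃ + d₃ * (a₃ + 2 * t * b₃) = -m ∧
    c₂ * b₁ + d₂ * (a₁ + 2 * t * b₁) + c₃ * b₄ + d₃ * (a₄ + 2 * t * b₄) = m := by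
  have h2t : 2 * t ≠ 0 := mul_ne_zero two_ne_zero ht
  refine ⟨?_, ?_, ?_, ?_⟩ <;> refine mul_left_cancel₀ h2t ?_
  · linear_combination (a₄ + 2 * t * b₄) * q₄ + (a₁ + 2 * t * b₁) * q₆ - a₄ * q₁ - a₁ * q₃ +
      (l + 2 * t * m) * (a₁ + 2 * t * b₁) * s₁ - l * a₁ * r₁
  · linear_combination (a₃ + 2 * t * b₃) * q₅ - (a₂ + 2 * t * b₂) * q₆ - a₃ * q₂ + a₂ * q₃
  · linear_combination -(a₂ + 2 * t * b₂) * q₄ + (a₃ + 2 * t * b₃) * q₆ + a₂ * q₁ - a₃ * q₃ -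
      (l + 2 * t * m) * s₂ + l * r₂
  · linear_combination (a₁ + 2 * t * b₁) * q₅ + (a₄ + 2 * t * b₄) * q₆ - a₁ * q₂ - a₄ * q₃ +
      (l + 2 * t * m) * s₂ - l * r₂ + (l + 2 * t * m) * (a₃ + 2 * t * b₃) * s₁ - l * a₃ * r₁

/-- The fundamental form is `λ Dp_i ∧ dq^i + μ dt ∧ p_i dq^i`. -/
theorem fundamentalBilin_eq (hn : 2 ≤ n) [Nonempty M] {A : EndoCoeffs}
    {C : MetricCoeffs} (hA : A.IsPositive) (h : IsAlmostHermitian g A C) {lam mu : ℝ → ℝ}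
    (hP : IsProportionality A C lam mu) (p : CotangentBundle n M)
    (ξ ζ : TangentSpace (cotangentModel n) p) :
    fundamentalBilin g A C p ξ ζ =
      lam (energy g p) * (verticalPart g p ξ (horizontalPart p ζ) -
        verticalPart g p ζ (horizontalPart p ξ)) +
      mu (energy g p) * (cometric g p.proj p.2 (verticalPart g p ξ) * p.2 (horizontalPart p ζ) -
        cometric g p.proj p.2 (verticalPart g p ζ) * p.2 (horizontalPart p ξ)) := by
  have ht := energy_nonneg g p
  obtain ⟨-, r1, r2, r3, r4⟩ := h.coeffRelations_orthogonal hn hA ht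
  obtain ⟨-, s1, s2, s3, s4⟩ := h.coeffRelations_radial hn hA ht
  have q1 := hP.c₁_eq _ ht
  have q2 := hP.c₂_eq _ ht
  have q3 := hP.c₃_eq _ ht
  have q4 := hP.cd₁_eq _ ht
  have q5 := hP.cd₂_eq _ ht
  have q6 := hP.cd₃_eq _ ht
  have hpp : cometric g p.proj p.2 p.2 = 2 * energy g p := apply_sharp_self g p
  have hzero : energy g p = 0 → p.2 = 0 := eq_zero_of_energy_eq_zero g
  have f1 : g.inner p.proj (horizontalPart p ξ) (horizontalPart p (naturalEndo g A p ζ)) = _ :=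
    apply_horizontalPart_naturalEndo g A p ζ (flat g p.proj (horizontalPart p ξ))
  have f2 := apply_horizontalPart_naturalEndo g A p ζ p.2
  have f3 := apply_horizontalPart_naturalEndo g A p ζ (verticalPart g p ξ)
  have v1 := verticalPart_naturalEndo_apply g A p ζ (horizontalPart p ξ)
  have v2 : cometric g p.proj (verticalPart g p ξ) (verticalPart g p (naturalEndo g A p ζ)) = _ :=
    (cometric_comm g _ _ _).trans
      (verticalPart_naturalEndo_apply g A p ζ (sharp g p.proj (verticalPart g p ξ)))
  have v3 : cometric g p.proj p.2 (verticalPart g p (naturalEndo g A p ζ)) = _ :=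
    (cometric_comm g _ _ _).trans
      (verticalPart_naturalEndo_apply g A p ζ (sharp g p.proj p.2))
  have k1 : flat g p.proj (horizontalPart p ξ) (horizontalPart p ζ) =
    g.inner p.proj (horizontalPart p ξ) (horizontalPart p ζ) := rfl
  have k2 : ∀ θ, cometric g p.proj (flat g p.proj (horizontalPart p ξ)) θ =
    θ (horizontalPart p ξ) := fun θ ↦ by rw [cometric_comm, cometric_flat]
  have k3 : ∀ θ : CotangentSpace n p.proj,
    g.inner p.proj (horizontalPart p ζ) (sharp g p.proj θ) = θ (horizontalPart p ζ) := fun θ ↦ by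
      rw [g.symm]
      exact congrArg (fun f : CotangentSpace n p.proj ↦ f _) (flat_sharp g p.proj θ)
  have k4 : ∀ θ η : CotangentSpace n p.proj, θ (sharp g p.proj η) = cometric g p.proj θ η :=
    fun _ _ ↦ rfl
  have k5 : cometric g p.proj (verticalPart g p ζ) (verticalPart g p ξ) =
    cometric g p.proj (verticalPart g p ξ) (verticalPart g p ζ) := cometric_comm g _ _ _
  have k6 : ∀ θ, cometric g p.proj θ p.2 = cometric g p.proj p.2 θ :=
    fun θ ↦ cometric_comm g _ _ _
  have k7 : g.inner p.proj (horizontalPart p ζ) (horizontalPart p ξ) =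
    g.inner p.proj (horizontalPart p ξ) (horizontalPart p ζ) := g.symm _ _ _
  rw [k1, k2, k2] at f1
  rw [hpp] at f2
  rw [k6 (verticalPart g p ξ)] at f3
  rw [k7] at v1
  rw [k3, k4, k4, k5] at v2
  rw [k3, k4, k4, hpp, k6 (verticalPart g p ζ)] at v3
  rw [fundamentalBilin]
  simp only [naturalMetric]
  rw [f1, f2, f3, v1, v2, v3]
  have z1 : energy g p = 0 → p.2 (horizontalPart p ξ) = 0 := fun h0 ↦ by rw [hzero h0]; rfl
  have z2 : energy g p = 0 → p.2 (horizontalPart p ζ) = 0 := fun h0 ↦ by rw [hzero h0]; rfl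
  have z3 : energy g p = 0 → cometric g p.proj p.2 (verticalPart g p ξ) = 0 :=
    fun h0 ↦ by rw [hzero h0]; rfl
  have z4 : energy g p = 0 → cometric g p.proj p.2 (verticalPart g p ζ) = 0 :=
    fun h0 ↦ by rw [hzero h0]; rfl
  clear f1 f2 f3 v1 v2 v3 k1 k2 k3 k4 k5 k6 k7 hzero hpp
  generalize p.2 (horizontalPart p ξ) = pX at *
  generalize p.2 (horizontalPart p ζ) = pY at *
  generalize cometric g p.proj p.2 (verticalPart g p ξ) = pθ at *
  generalize cometric g p.proj p.2 (verticalPart g p ζ) = pη at *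
  generalize verticalPart g p ξ (horizontalPart p ζ) = θY at *
  generalize verticalPart g p ζ (horizontalPart p ξ) = ηX at *
  generalize cometric g p.proj (verticalPart g p ξ) (verticalPart g p ζ) = θη at *
  generalize g.inner p.proj (horizontalPart p ξ) (horizontalPart p ζ) = XY at *
  have o₁ : C.c₁ (energy g p) * A.a₄ (energy g p) + C.c₃ (energy g p) * A.a₁ (energy g p) = 0 := by
    linear_combination r4 + C.c₁ (energy g p) * r1
  have o₂ : C.c₂ (energy g p) * A.a₃ (energy g p) - C.c₃ (energy g p) * A.a₂ (energy g p) = 0 := by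
    linear_combination A.a₃ (energy g p) * q2 - A.a₂ (energy g p) * q3
  have o₃ : C.c₂ (energy g p) * A.a₁ (energy g p) + C.c₃ (energy g p) * A.a₄ (energy g p) =
      lam (energy g p) := by
    linear_combination A.a₁ (energy g p) * q2 + A.a₄ (energy g p) * q3 + lam (energy g p) * r2 +
      lam (energy g p) * A.a₃ (energy g p) * r1
  have o₄ : -C.c₁ (energy g p) * A.a₂ (energy g p) + C.c₃ (energy g p) * A.a₃ (energy g p) =
      -lam (energy g p) := by
    linear_combination -A.a₂ (energy g p) * q1 + A.a₃ (energy g p) * q3 - lam (energy g p) * r2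
  by_cases h0 : energy g p = 0
  · rw [z1 h0, z2 h0, z3 h0, z4 h0]
    linear_combination XY * o₁ + θη * o₂ + θY * o₃ + ηX * o₄
  · obtain ⟨w₁, w₂, w₃, w₄⟩ := radial_coeff_identities h0 r1 r2 s1 s2 q1 q2 q3 q4 q5 q6
    linear_combination XY * o₁ + θη * o₂ + θY * o₃ + ηX * o₄ + pX * pY * w₁ + pθ * pη * w₂ +
      pX * pη * w₃ + pY * pθ * w₄

set_option maxSynthPendingDepth 3
set_option synthInstance.maxHeartbeats 100000

section TwoForm

variable (V : Type*) [NormedAddCommGroup V] [NormedSpace ℝ V]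

/-- A covector as an alternating form of degree one. -/
def oneForm : (V →L[ℝ] ℝ) →L[ℝ] V [⋀^Fin 1]→L[ℝ] ℝ :=
  ((ContinuousAlternatingMap.ofSubsingletonLIE (𝕜 := ℝ) (E := V) (F := ℝ)
    (0 : Fin 1)).toContinuousLinearEquiv : (V →L[ℝ] ℝ) →L[ℝ] V [⋀^Fin 1]→L[ℝ] ℝ)

/-- The alternating form `(u, v) ↦ B(u, v) - B(v, u)`. -/
def twoForm : (V →L[ℝ] V →L[ℝ] ℝ) →L[ℝ] V [⋀^Fin 2]→L[ℝ] ℝ :=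
  (ContinuousAlternatingMap.alternatizeUncurryFinCLM ℝ V ℝ).comp
    (ContinuousLinearMap.compL ℝ V (V →L[ℝ] ℝ) (V [⋀^Fin 1]→L[ℝ] ℝ) (oneForm V))

variable {V}

theorem oneForm_apply (α : V →L[ℝ] ℝ) (v : Fin 1 → V) : oneForm V α v = α (v 0) := rfl

theorem twoForm_apply (B : V →L[ℝ] V →L[ℝ] ℝ) (v : Fin 2 → V) :
    twoForm V B v = B (v 0) (v 1) - B (v 1) (v 0) := by
  have h : twoForm V B v =
      ContinuousAlternatingMap.alternatizeUncurryFin ((oneForm V).comp B) v := rfl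
  rw [h, ContinuousAlternatingMap.alternatizeUncurryFin_apply, Fin.sum_univ_two]
  simp [oneForm_apply, Fin.removeNth, sub_eq_add_neg, Fin.tail]

theorem extDeriv_oneForm {α : V → V →L[ℝ] ℝ} {z : V} {α' : V →L[ℝ] V →L[ℝ] ℝ}
    (h : HasFDerivAt α α' z) : extDeriv (fun z ↦ oneForm V (α z)) z = twoForm V α' := by
  have h1 : HasFDerivAt (fun z ↦ oneForm V (α z)) ((oneForm V).comp α') z :=
    (oneForm V).hasFDerivAt.comp z h
  rw [extDeriv, h1.fderiv]
  rfl

theorem extDeriv_twoForm_apply {B : V → V →L[ℝ] V →L[ℝ] ℝ} {z : V}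
    {B' : V →L[ℝ] V →L[ℝ] V →L[ℝ] ℝ} (h : HasFDerivAt B B' z) (v : Fin 3 → V) :
    extDeriv (fun z ↦ twoForm V (B z)) z v =
      (B' (v 0) (v 1) (v 2) - B' (v 0) (v 2) (v 1)) -
      (B' (v 1) (v 0) (v 2) - B' (v 1) (v 2) (v 0)) +
      (B' (v 2) (v 0) (v 1) - B' (v 2) (v 1) (v 0)) := by
  have h1 : HasFDerivAt (fun z ↦ twoForm V (B z)) ((twoForm V).comp B') z :=
    (twoForm V).hasFDerivAt.comp z h
  rw [extDeriv, h1.fderiv, ContinuousAlternatingMap.alternatizeUncurryFin_apply,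
    Fin.sum_univ_three]
  simp only [ContinuousLinearMap.comp_apply, twoForm_apply, Fin.removeNth]
  have h12 : Fin.succAbove (1 : Fin 3) 1 = 2 := rfl
  have h20 : Fin.succAbove (2 : Fin 3) 0 = 0 := rfl
  have h21 : Fin.succAbove (2 : Fin 3) 1 = 1 := rfl
  simp [h12, h20, h21]
  ring

/-- The exterior derivative of `λ(τ) dϑ + μ(τ) dτ ∧ ϑ`, for a one-form `ϑ` with linear
coefficients. -/
theorem extDeriv_twoForm_add_wedge {τ : V → ℝ} {z : V}
    (hτ : ContDiffAt ℝ 2 τ z) (hpos : ∀ y, 0 ≤ τ y) {lam mu : ℝ → ℝ}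
    (hlam : DifferentiableOn ℝ lam (Ici 0)) (hmu : DifferentiableOn ℝ mu (Ici 0))
    (L : V →L[ℝ] V →L[ℝ] ℝ) (v : Fin 3 → V) :
    extDeriv (fun y ↦ twoForm V (lam (τ y) • L + mu (τ y) • (fderiv ℝ τ y).smulRight (L y))) z v =
      (derivWithin lam (Ici 0) (τ z) - mu (τ z)) *
        (fderiv ℝ τ z (v 0) * (L (v 1) (v 2) - L (v 2) (v 1)) -
          fderiv ℝ τ z (v 1) * (L (v 0) (v 2) - L (v 2) (v 0)) +
          fderiv ℝ τ z (v 2) * (L (v 0) (v 1) - L (v 1) (v 0))) := by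
  have hd : HasFDerivAt τ (fderiv ℝ τ z) z := (hτ.differentiableAt (by simp)).hasFDerivAt
  have hd2 : HasFDerivAt (fderiv ℝ τ) (fderiv ℝ (fderiv ℝ τ) z) z :=
    ((hτ.fderiv_right (m := 1) le_rfl).differentiableAt (by simp)).hasFDerivAt
  have hsymm : IsSymmSndFDerivAt ℝ τ z := hτ.isSymmSndFDerivAt (by simp)
  have hcomp : ∀ f : ℝ → ℝ, DifferentiableOn ℝ f (Ici 0) →
      HasFDerivAt (fun y ↦ f (τ y)) (derivWithin f (Ici 0) (τ z) • fderiv ℝ τ z) z := by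
    intro f hf
    have h1 := (hf (τ z) (hpos z)).hasDerivWithinAt
    exact h1.comp_hasFDerivAt z hd (Filter.Eventually.of_forall hpos)
  have hw : HasFDerivAt (fun y ↦ (fderiv ℝ τ y).smulRight (L y)) _ z :=
    HasFDerivAt.clm_apply
      ((ContinuousLinearMap.smulRightL ℝ V (V →L[ℝ] ℝ)).hasFDerivAt.comp z hd2) L.hasFDerivAt
  have hB := ((hcomp lam hlam).smul (hasFDerivAt_const L z)).add ((hcomp mu hmu).smul hw)
  refine (extDeriv_twoForm_apply hB v).trans ?_
  have s1 := hsymm (v 0) (v 1)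
  have s2 := hsymm (v 0) (v 2)
  have s3 := hsymm (v 1) (v 2)
  simp
  rw [s1, s2, s3]
  ring

end TwoForm

section Liouville

variable (E : Type*) [NormedAddCommGroup E] [NormedSpace ℝ E]

/-- The Liouville form `(q, η) ↦ ((u, α) ↦ η(u))` of `E × E^*`. -/
def liouville : E × (E →L[ℝ] ℝ) →L[ℝ] E × (E →L[ℝ] ℝ) →L[ℝ] ℝ :=
  ((ContinuousLinearMap.compL ℝ (E × (E →L[ℝ] ℝ)) E ℝ).flip
    (ContinuousLinearMap.fst ℝ E (E →L[ℝ] ℝ))).comp (ContinuousLinearMap.snd ℝ E (E →L[ℝ] ℝ))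

variable {E}

theorem liouville_apply (z w : E × (E →L[ℝ] ℝ)) : liouville E z w = z.2 w.1 := rfl

/-- The canonical symplectic form is preserved by a map that preserves the Liouville form. -/
theorem symplectic_eq_of_liouville_eq {F : E × (E →L[ℝ] ℝ) → E × (E →L[ℝ] ℝ)}
    {z : E × (E →L[ℝ] ℝ)} (hF : ContDiffAt ℝ 2 F z)
    (h : ∀ᶠ y in 𝓝 z, ∀ w, (F y).2 (fderiv ℝ F y w).1 = y.2 w.1) (v w : E × (E →L[ℝ] ℝ)) :
    (fderiv ℝ F z v).2 (fderiv ℝ F z w).1 - (fderiv ℝ F z w).2 (fderiv ℝ F z v).1 =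
      v.2 w.1 - w.2 v.1 := by
  have hd : ∀ y, HasFDerivAt (fun y ↦ liouville E y) (liouville E) y := fun y ↦
    (liouville E).hasFDerivAt
  have h1 : extDeriv (fun y ↦
      (oneForm (E × (E →L[ℝ] ℝ)) (liouville E (F y))).compContinuousLinearMap (fderiv ℝ F y)) z = (extDeriv (fun y ↦ oneForm (E × (E →L[ℝ] ℝ)) (liouville E y))
      (F z)).compContinuousLinearMap (fderiv ℝ F z) := extDeriv_pullback (r := 2) (f := F) (x := z)
    ((oneForm (E × (E →L[ℝ] ℝ))).differentiableAt.comp _ (hd (F z)).differentiableAt) hF (by simp)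
  have h2 : (fun y ↦ (oneForm (E × (E →L[ℝ] ℝ)) (liouville E (F y))).compContinuousLinearMap
      (fderiv ℝ F y)) =ᶠ[𝓝 z] fun y ↦ oneForm (E × (E →L[ℝ] ℝ)) (liouville E y) := by
    filter_upwards [h] with y hy
    ext v
    exact hy (v 0)
  rw [h2.extDeriv_eq, extDeriv_oneForm (hd _), extDeriv_oneForm (hd _)] at h1
  have h3 := congrArg (fun f ↦ f ![v, w]) h1
  exact (twoForm_apply (liouville E) (fderiv ℝ F z ∘ ![v, w])).symm.trans
    (h3.symm.trans (twoForm_apply (liouville E) ![v, w]))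

end Liouville

omit [IsManifold (𝓡 n) ∞ M] in
theorem mfderiv_extChartAt_symm [IsManifold (𝓡 n) 1 M] {x₀ : M} {q : Model n}
    (hq : q ∈ (extChartAt (𝓡 n) x₀).target) :
    mfderiv 𝓘(ℝ, Model n) (𝓡 n) (extChartAt (𝓡 n) x₀).symm q =
      (trivializationAt (Model n) (TangentSpace (𝓡 n)) x₀).symmL ℝ
        ((extChartAt (𝓡 n) x₀).symm q) := by
  have h := (extChartAt (𝓡 n) x₀).map_target hq
  rw [extChartAt_source] at h
  rw [TangentBundle.symmL_trivializationAt h, (extChartAt (𝓡 n) x₀).right_inv hq,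
    ModelWithCorners.range_eq_univ, mfderivWithin_univ]

theorem extChartAt_cotangent_apply (p w : CotangentBundle n M) :
    extChartAt (cotangentModel n) p w = (extChartAt (𝓡 n) p.proj w.proj,
      w.2.comp ((trivializationAt (Model n) (TangentSpace (𝓡 n)) p.proj).symmL ℝ w.proj)) := by
  rw [FiberBundle.extChartAt]
  refine Prod.ext rfl ?_
  ext u
  simp [hom_trivializationAt_apply, ContinuousLinearMap.inCoordinates]

theorem extChartAt_cotangent_symm_apply (p : CotangentBundle n M)
    (z : Model n × (Model n →L[ℝ] ℝ)) :
    (extChartAt (cotangentModel n) p).symm z =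
      (⟨(extChartAt (𝓡 n) p.proj).symm z.1,
        z.2.comp ((trivializationAt (Model n) (TangentSpace (𝓡 n)) p.proj).continuousLinearMapAt ℝ
          ((extChartAt (𝓡 n) p.proj).symm z.1))⟩ : CotangentBundle n M) := by
  have h : ∀ L : CotangentSpace n ((extChartAt (𝓡 n) p.proj).symm z.1),
    ((Bundle.Trivial.trivialization M ℝ).symmL ℝ
      ((extChartAt (𝓡 n) p.proj).symm z.1)).comp L = L := by
    intro L
    rw [Bundle.Trivial.symmL_trivialization]
    rfl
  rw [FiberBundle.extChartAt]
  exact congrArg (fun L : CotangentSpace n ((extChartAt (𝓡 n) p.proj).symm z.1) ↦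
    (⟨(extChartAt (𝓡 n) p.proj).symm z.1, L⟩ : CotangentBundle n M)) (h _)

theorem cotangent_target (p : CotangentBundle n M) :
    (extChartAt (cotangentModel n) p).target =
      (extChartAt (𝓡 n) p.proj).target ×ˢ univ := by
  rw [FiberBundle.extChartAt_target]
  congr 1
  refine inter_eq_left.2 fun q hq ↦ ?_
  have h := (extChartAt (𝓡 n) p.proj).map_target hq
  rw [extChartAt_source] at h
  exact ⟨h, mem_univ _⟩

theorem extChartAt_cotangent_self (p : CotangentBundle n M) :
    extChartAt (cotangentModel n) p p = (extChartAt (𝓡 n) p.proj p.proj, p.2) := by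
  rw [extChartAt_cotangent_apply]
  have h : (trivializationAt (Model n) (TangentSpace (𝓡 n)) p.proj).symmL ℝ p.proj =
      ContinuousLinearMap.id ℝ (Model n) := by
    rw [TangentBundle.symmL_trivializationAt (mem_chart_source _ _)]
    exact mfderivWithin_range_extChartAt_symm
  rw [h]
  rfl

/-- The covector with coordinates `z` pairs with `∂/∂x^i` to the `i`-th fibre coordinate of `z`. -/
theorem extChartAt_cotangent_symm_snd_apply (p : CotangentBundle n M)
    {z : Model n × (Model n →L[ℝ] ℝ)} (hz : z.1 ∈ (extChartAt (𝓡 n) p.proj).target)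
    (u : Model n) :
    ((extChartAt (cotangentModel n) p).symm z).2
      ((trivializationAt (Model n) (TangentSpace (𝓡 n)) p.proj).symmL ℝ
        ((extChartAt (cotangentModel n) p).symm z).proj u) = z.2 u := by
  have h := (extChartAt (𝓡 n) p.proj).map_target hz
  rw [extChartAt_source] at h
  rw [extChartAt_cotangent_symm_apply]
  exact congrArg z.2 (Trivialization.continuousLinearMapAt_symmL _ h u)

/-- The change of coordinates of `T^*M` from the chart at `p` to the chart at `w`. -/
def cotangentTransition (p w : CotangentBundle n M) (z : Model n × (Model n →L[ℝ] ℝ)) :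
    Model n × (Model n →L[ℝ] ℝ) :=
  extChartAt (cotangentModel n) w ((extChartAt (cotangentModel n) p).symm z)

variable {p w : CotangentBundle n M} {z : Model n × (Model n →L[ℝ] ℝ)}

theorem contDiffAt_cotangentTransition (hz : z ∈ (extChartAt (cotangentModel n) p).target)
    (hw : (extChartAt (cotangentModel n) p).symm z ∈ (extChartAt (cotangentModel n) w).source) :
    ContDiffAt ℝ ∞ (cotangentTransition p w) z := by
  have h := contDiffWithinAt_ext_coord_change (I := cotangentModel n) (n := ∞) w p (y := z) (by
    rw [PartialEquiv.trans_source'', PartialEquiv.symm_symm, PartialEquiv.symm_target]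
    exact ⟨_, ⟨(extChartAt (cotangentModel n) p).map_target hz, hw⟩,
      (extChartAt (cotangentModel n) p).right_inv hz⟩)
  rw [ModelWithCorners.range_eq_univ, contDiffWithinAt_univ] at h
  exact h

theorem mfderiv_cotangent_symm (hz : z ∈ (extChartAt (cotangentModel n) p).target) :
    mfderiv 𝓘(ℝ, Model n × (Model n →L[ℝ] ℝ)) (cotangentModel n)
      (extChartAt (cotangentModel n) p).symm z =
      fderiv ℝ (cotangentTransition p ((extChartAt (cotangentModel n) p).symm z)) z := by
  have h : MDifferentiableAt 𝓘(ℝ, Model n × (Model n →L[ℝ] ℝ)) (cotangentModel n)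
      (extChartAt (cotangentModel n) p).symm z := by
    have h1 := mdifferentiableWithinAt_extChartAt_symm (I := cotangentModel n) hz
    rwa [ModelWithCorners.range_eq_univ, mdifferentiableWithinAt_univ] at h1
  rw [h.mfderiv, ModelWithCorners.range_eq_univ, fderivWithin_univ]
  rfl

theorem liouville_cotangentTransition (hz : z ∈ (extChartAt (cotangentModel n) p).target)
    (hw : (extChartAt (cotangentModel n) p).symm z ∈ (extChartAt (cotangentModel n) w).source)
    (v : Model n × (Model n →L[ℝ] ℝ)) :
    (cotangentTransition p w z).2 (fderiv ℝ (cotangentTransition p w) z v).1 = z.2 v.1 := by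
  have hz1 : z.1 ∈ (extChartAt (𝓡 n) p.proj).target := by
    rw [cotangent_target] at hz; exact hz.1
  have hproj : ((extChartAt (cotangentModel n) p).symm z).proj =
    (extChartAt (𝓡 n) p.proj).symm z.1 := by rw [extChartAt_cotangent_symm_apply]
  have hsrc : ((extChartAt (cotangentModel n) p).symm z).proj ∈
      (extChartAt (𝓡 n) p.proj).source ∩ (extChartAt (𝓡 n) w.proj).source := by
    refine ⟨hproj ▸ (extChartAt (𝓡 n) p.proj).map_target hz1, ?_⟩
    rw [FiberBundle.extChartAt] at hw
    have := hw.2.1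
    exact this
  have hf := hasFDerivWithinAt_tangentCoordChange hsrc
  rw [hproj, (extChartAt (𝓡 n) p.proj).right_inv hz1, ModelWithCorners.range_eq_univ,
    hasFDerivWithinAt_univ, ← hproj] at hf
  have hF := ((contDiffAt_cotangentTransition hz hw).differentiableAt (by simp)).hasFDerivAt
  have h1 : HasFDerivAt (fun y ↦ (cotangentTransition p w y).1)
      ((ContinuousLinearMap.fst ℝ _ _).comp (fderiv ℝ (cotangentTransition p w) z)) z := hF.fst
  have h2 : (fun y ↦ (cotangentTransition p w y).1) =
      (extChartAt (𝓡 n) w.proj ∘ (extChartAt (𝓡 n) p.proj).symm) ∘ Prod.fst := by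
    ext1 y
    rw [cotangentTransition, extChartAt_cotangent_apply, extChartAt_cotangent_symm_apply]
    rfl
  rw [h2] at h1
  have h3 := h1.unique (hf.comp z hasFDerivAt_fst)
  have h4 := congrArg (fun L : Model n × (Model n →L[ℝ] ℝ) →L[ℝ] Model n ↦ L v) h3
  have h5 : (fderiv ℝ (cotangentTransition p w) z v).1 =
    tangentCoordChange (𝓡 n) p.proj w.proj ((extChartAt (cotangentModel n) p).symm z).proj v.1 := h4
  rw [h5, cotangentTransition, extChartAt_cotangent_apply]
  rw [← extChartAt_cotangent_symm_snd_apply p hz1]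
  generalize (extChartAt (cotangentModel n) p).symm z = w' at *
  refine congrArg w'.2 ?_
  rw [TangentBundle.symmL_trivializationAt_eq_core (by simpa using hsrc.2),
    TangentBundle.symmL_trivializationAt_eq_core (by simpa using hsrc.1)]
  exact tangentCoordChange_comp (I := 𝓡 n) (w := p.proj) (x := w.proj) (y := w'.proj)
    ⟨hsrc, mem_extChartAt_source _⟩

theorem symplectic_cotangentTransition (hz : z ∈ (extChartAt (cotangentModel n) p).target)
    (hw : (extChartAt (cotangentModel n) p).symm z ∈ (extChartAt (cotangentModel n) w).source)
    (u v : Model n × (Model n →L[ℝ] ℝ)) :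
    (fderiv ℝ (cotangentTransition p w) z u).2 (fderiv ℝ (cotangentTransition p w) z v).1 -
      (fderiv ℝ (cotangentTransition p w) z v).2 (fderiv ℝ (cotangentTransition p w) z u).1 =
      u.2 v.1 - v.2 u.1 := by
  refine symplectic_eq_of_liouville_eq
    ((contDiffAt_cotangentTransition hz hw).of_le (by norm_cast)) ?_ u v
  filter_upwards [(isOpen_extChartAt_target p).mem_nhds hz,
    (continuousAt_extChartAt_symm'' hz).preimage_mem_nhds
      ((isOpen_extChartAt_source w).mem_nhds hw)] with y hy hy'
  exact liouville_cotangentTransition hy hy'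

/-- The metric in the preferred chart at `x₀`, as a function of the coordinates. -/
def gram (x₀ : M) (q : Model n) : Model n →L[ℝ] Model n →L[ℝ] ℝ :=
  ContinuousLinearMap.bilinearComp (E := Model n) (F := Model n)
    (g.inner ((extChartAt (𝓡 n) x₀).symm q) : Model n →L[ℝ] Model n →L[ℝ] ℝ)
    (mfderiv 𝓘(ℝ, Model n) (𝓡 n) (extChartAt (𝓡 n) x₀).symm q : Model n →L[ℝ] Model n)
    (mfderiv 𝓘(ℝ, Model n) (𝓡 n) (extChartAt (𝓡 n) x₀).symm q : Model n →L[ℝ] Model n)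

theorem gram_apply (x₀ : M) (q u v : Model n) :
    gram g x₀ q u v = g.inner ((extChartAt (𝓡 n) x₀).symm q)
      (mfderiv 𝓘(ℝ, Model n) (𝓡 n) (extChartAt (𝓡 n) x₀).symm q u)
      (mfderiv 𝓘(ℝ, Model n) (𝓡 n) (extChartAt (𝓡 n) x₀).symm q v) := rfl

theorem gram_comm (x₀ : M) (q u v : Model n) : gram g x₀ q u v = gram g x₀ q v u :=
  g.symm _ _ _

theorem gram_apply_symmL {x₀ : M} {q : Model n} (hq : q ∈ (extChartAt (𝓡 n) x₀).target)
    (u v : Model n) :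
    gram g x₀ q u v = g.inner ((extChartAt (𝓡 n) x₀).symm q)
      ((trivializationAt (Model n) (TangentSpace (𝓡 n)) x₀).symmL ℝ
        ((extChartAt (𝓡 n) x₀).symm q) u)
      ((trivializationAt (Model n) (TangentSpace (𝓡 n)) x₀).symmL ℝ
        ((extChartAt (𝓡 n) x₀).symm q) v) := by
  rw [gram_apply, mfderiv_extChartAt_symm hq]
  rfl

theorem gram_eq_inCoordinates {x₀ : M} {q : Model n} (hq : q ∈ (extChartAt (𝓡 n) x₀).target) :
    gram g x₀ q = ContinuousLinearMap.inCoordinates (Model n) (TangentSpace (𝓡 n))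
      (Model n →L[ℝ] ℝ) (fun x : M ↦ TangentSpace (𝓡 n) x →L[ℝ] ℝ) x₀
      ((extChartAt (𝓡 n) x₀).symm q) x₀ ((extChartAt (𝓡 n) x₀).symm q)
      (g.inner ((extChartAt (𝓡 n) x₀).symm q)) := by
  have h := (extChartAt (𝓡 n) x₀).map_target hq
  rw [extChartAt_source] at h
  ext u v
  rw [gram_apply_symmL g hq]
  symm
  refine (inCoordinates_apply_eq₂ (F₃ := ℝ) (E₃ := Bundle.Trivial M ℝ)
    h h (mem_univ _)).trans ?_
  rw [Trivialization.symmL_apply _ (R := ℝ) h, Trivialization.symmL_apply _ (R := ℝ) h]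
  simp

theorem contDiffAt_gram (x₀ : M) : ContDiffAt ℝ ∞ (gram g x₀) (extChartAt (𝓡 n) x₀ x₀) := by
  have h1 := (contMDiffAt_hom_bundle _).1 (g.contMDiff x₀)
  have h2 : ContMDiffAt 𝓘(ℝ, Model n) (𝓡 n) ∞ (extChartAt (𝓡 n) x₀).symm
      (extChartAt (𝓡 n) x₀ x₀) :=
    (contMDiffOn_extChartAt_symm x₀).contMDiffAt (extChartAt_target_mem_nhds x₀)
  have h3 := h1.2
  rw [← extChartAt_to_inv (I := 𝓡 n) x₀] at h3
  have h4 := (h3.comp (extChartAt (𝓡 n) x₀ x₀) h2).contDiffAt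
  refine h4.congr_of_eventuallyEq ?_
  filter_upwards [extChartAt_target_mem_nhds (I := 𝓡 n) x₀] with q hq
  rw [gram_eq_inCoordinates g hq]
  simp

omit [IsManifold (𝓡 n) ∞ M] in
theorem symmL_trivializationAt_self [IsManifold (𝓡 n) 1 M] (x : M) (u : Model n) :
    (trivializationAt (Model n) (TangentSpace (𝓡 n)) x).symmL ℝ x u = u := by
  rw [TangentBundle.symmL_trivializationAt (mem_chart_source _ _),
    mfderivWithin_range_extChartAt_symm]
  rfl

theorem gram_self (x : M) (u v : Model n) :
    gram g x (extChartAt (𝓡 n) x x) u v = g.inner x u v := by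
  have key : ∀ x' : M, x' = x →
      g.inner x' ((trivializationAt (Model n) (TangentSpace (𝓡 n)) x).symmL ℝ x' u)
        ((trivializationAt (Model n) (TangentSpace (𝓡 n)) x).symmL ℝ x' v) = g.inner x u v := by
    rintro x' rfl
    rw [symmL_trivializationAt_self, symmL_trivializationAt_self]
  rw [gram_apply_symmL g (mem_extChartAt_target x)]
  exact key _ (extChartAt_to_inv x)

theorem exists_equiv_of_pos {B : Model n →L[ℝ] Model n →L[ℝ] ℝ} (hB : ∀ v, v ≠ 0 → 0 < B v v) :
    ∃ L : Model n ≃L[ℝ] (Model n →L[ℝ] ℝ), (L : Model n →L[ℝ] Model n →L[ℝ] ℝ) = B := by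
  have hinj : Function.Injective B := by
    rw [injective_iff_map_eq_zero]
    intro v hv
    by_contra hne
    have h1 := hB v hne
    rw [hv] at h1
    exact lt_irrefl _ h1
  have hdim : Module.finrank ℝ (Model n) = Module.finrank ℝ (Model n →L[ℝ] ℝ) := by
    rw [← (LinearMap.toContinuousLinearMap (𝕜 := ℝ) (E := Model n) (F' := ℝ)).finrank_eq]
    exact (Subspace.dual_finrank_eq (K := ℝ) (V := Model n)).symm
  have hbij : Function.Bijective B :=
    ⟨hinj, (LinearMap.injective_iff_surjective_of_finrank_eq_finrank (f := (B : Model n →ₗ[ℝ] _))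
      hdim).1 hinj⟩
  exact ⟨(LinearEquiv.ofBijective (B : Model n →ₗ[ℝ] _) hbij).toContinuousLinearEquiv, by ext; rfl⟩

theorem gram_pos {x₀ : M} {q : Model n} (hq : q ∈ (extChartAt (𝓡 n) x₀).target) {v : Model n}
    (hv : v ≠ 0) : 0 < gram g x₀ q v v := by
  have h := (extChartAt (𝓡 n) x₀).map_target hq
  rw [extChartAt_source] at h
  rw [gram_apply_symmL g hq]
  refine g.pos _ _ fun h0 ↦ hv ?_
  have h1 := Trivialization.continuousLinearMapAt_symmL (R := ℝ)
    (trivializationAt (Model n) (TangentSpace (𝓡 n)) x₀) h v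
  exact (h1.symm.trans (congrArg ((trivializationAt (Model n) (TangentSpace (𝓡 n))
    x₀).continuousLinearMapAt ℝ ((extChartAt (𝓡 n) x₀).symm q)) h0)).trans
    (ContinuousLinearMap.map_zero _)

/-- The energy density in the preferred chart at `p`. -/
def energyInChart (p : CotangentBundle n M) (z : Model n × (Model n →L[ℝ] ℝ)) : ℝ :=
  energy g ((extChartAt (cotangentModel n) p).symm z)

theorem sharp_extChartAt_symm (p : CotangentBundle n M) {z : Model n × (Model n →L[ℝ] ℝ)}
    (hz : z.1 ∈ (extChartAt (𝓡 n) p.proj).target) :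
    sharp g ((extChartAt (cotangentModel n) p).symm z).proj
      ((extChartAt (cotangentModel n) p).symm z).2 =
      (trivializationAt (Model n) (TangentSpace (𝓡 n)) p.proj).symmL ℝ
        ((extChartAt (cotangentModel n) p).symm z).proj ((gram g p.proj z.1).inverse z.2) := by
  obtain ⟨L, hL⟩ := exists_equiv_of_pos fun v ↦ gram_pos g hz (v := v)
  have h := (extChartAt (𝓡 n) p.proj).map_target hz
  rw [extChartAt_source] at h
  have hproj : ((extChartAt (cotangentModel n) p).symm z).proj =
    (extChartAt (𝓡 n) p.proj).symm z.1 := by rw [extChartAt_cotangent_symm_apply]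
  have hg : ∀ u v, gram g p.proj z.1 u v =
      g.inner ((extChartAt (cotangentModel n) p).symm z).proj
        ((trivializationAt (Model n) (TangentSpace (𝓡 n)) p.proj).symmL ℝ
          ((extChartAt (cotangentModel n) p).symm z).proj u)
        ((trivializationAt (Model n) (TangentSpace (𝓡 n)) p.proj).symmL ℝ
          ((extChartAt (cotangentModel n) p).symm z).proj v) := by
    intro u v
    rw [gram_apply_symmL g hz, hproj]
  have hw := extChartAt_cotangent_symm_snd_apply p hz
  rw [← hproj] at h
  generalize (extChartAt (cotangentModel n) p).symm z = w at *
  rw [← sharp_flat g w.proj ((trivializationAt (Model n) (TangentSpace (𝓡 n)) p.proj).symmL ℝ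
        w.proj ((gram g p.proj z.1).inverse z.2))]
  congr 1
  ext v
  have h1 := Trivialization.symmL_continuousLinearMapAt (R := ℝ)
    (trivializationAt (Model n) (TangentSpace (𝓡 n)) p.proj) h v
  rw [← h1, hw]
  refine Eq.trans ?_ (hg _ _)
  rw [← hL, ContinuousLinearMap.inverse_equiv]
  exact (congrArg (fun f : Model n →L[ℝ] ℝ ↦ f _) (L.apply_symm_apply z.2)).symm

theorem energyInChart_eq (p : CotangentBundle n M) {z : Model n × (Model n →L[ℝ] ℝ)}
    (hz : z.1 ∈ (extChartAt (𝓡 n) p.proj).target) :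
    energyInChart g p z = (1 / 2) * z.2 ((gram g p.proj z.1).inverse z.2) := by
  rw [energyInChart, energy, cometric, sharp_extChartAt_symm g p hz,
    extChartAt_cotangent_symm_snd_apply p hz]

theorem hasFDerivAt_half_inverse {E : Type*} [NormedAddCommGroup E] [NormedSpace ℝ E]
    [CompleteSpace E] {G : E → E →L[ℝ] E →L[ℝ] ℝ} {z : E × (E →L[ℝ] ℝ)} {k : WithTop ℕ∞}
    (hk : 1 ≤ k) (hG : ContDiffAt ℝ k G z.1) (L : E ≃L[ℝ] (E →L[ℝ] ℝ))
    (hL : (L : E →L[ℝ] E →L[ℝ] ℝ) = G z.1) (hsymm : ∀ u v, G z.1 u v = G z.1 v u) :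
    ContDiffAt ℝ k (fun y : E × (E →L[ℝ] ℝ) ↦ (1 / 2 : ℝ) * y.2 ((G y.1).inverse y.2)) z ∧
    ∀ ξ, fderiv ℝ (fun y : E × (E →L[ℝ] ℝ) ↦ (1 / 2 : ℝ) * y.2 ((G y.1).inverse y.2)) z ξ =
      ξ.2 (L.symm z.2) - (1 / 2) * fderiv ℝ G z.1 ξ.1 (L.symm z.2) (L.symm z.2) := by
  have hG1 : ContDiffAt ℝ k (fun y : E × (E →L[ℝ] ℝ) ↦ G y.1) z := hG.comp z contDiffAt_fst
  have hinv : ContDiffAt ℝ k (fun y : E × (E →L[ℝ] ℝ) ↦ (G y.1).inverse) z := by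
    have h := contDiffAt_map_inverse (n := k) L
    rw [hL] at h
    exact h.comp z hG1
  have hY : ContDiffAt ℝ k (fun y : E × (E →L[ℝ] ℝ) ↦ (G y.1).inverse y.2) z :=
    hinv.clm_apply contDiffAt_snd
  have hτ : ContDiffAt ℝ k (fun y : E × (E →L[ℝ] ℝ) ↦ (1 / 2 : ℝ) * y.2 ((G y.1).inverse y.2)) z :=
    contDiffAt_const.mul (contDiffAt_snd.clm_apply hY)
  refine ⟨hτ, fun ξ ↦ ?_⟩
  have hk0 : k ≠ 0 := by rintro rfl; simp at hk
  have dG := (hG.differentiableAt hk0).hasFDerivAt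
  have dG1 : HasFDerivAt (fun y : E × (E →L[ℝ] ℝ) ↦ G y.1) _ z := dG.comp z hasFDerivAt_fst
  have dY := (hY.differentiableAt hk0).hasFDerivAt
  have hYz : (G z.1).inverse z.2 = L.symm z.2 := by
    rw [← hL, ContinuousLinearMap.inverse_equiv]
    rfl
  have dτ := (hasFDerivAt_snd.clm_apply dY).const_mul (1 / 2 : ℝ)
  have dGY := dG1.clm_apply dY
  have hev : (fun y : E × (E →L[ℝ] ℝ) ↦ G y.1 ((G y.1).inverse y.2)) =ᶠ[𝓝 z] Prod.snd := by
    have h1 : ∀ᶠ y in 𝓝 z, G y.1 ∈ range ((↑) : (E ≃L[ℝ] (E →L[ℝ] ℝ)) → E →L[ℝ] E →L[ℝ] ℝ) := by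
      have h2 := ContinuousLinearEquiv.nhds L
      rw [hL] at h2
      exact hG1.continuousAt h2
    filter_upwards [h1] with y ⟨L', hL'⟩
    rw [← hL', ContinuousLinearMap.inverse_equiv]
    exact L'.apply_symm_apply _
  have h3 := dGY.unique (hasFDerivAt_snd.congr_of_eventuallyEq hev)
  have h4 := congrArg (fun T : E × (E →L[ℝ] ℝ) →L[ℝ] E →L[ℝ] ℝ ↦ T ξ (L.symm z.2)) h3
  have h5 := hsymm (fderiv ℝ (fun y : E × (E →L[ℝ] ℝ) ↦ (G y.1).inverse y.2) z ξ) (L.symm z.2)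
  have h6 : G z.1 (L.symm z.2) = z.2 := by rw [← hL]; exact L.apply_symm_apply _
  rw [dτ.fderiv]
  rw [h6] at h5
  simp [hYz] at h4 ⊢
  linarith

variable (p : CotangentBundle n M)

theorem energyInChart_eventuallyEq : energyInChart g p =ᶠ[𝓝 (extChartAt (cotangentModel n) p p)]
    fun z ↦ (1 / 2) * z.2 ((gram g p.proj z.1).inverse z.2) := by
  filter_upwards [extChartAt_target_mem_nhds (I := cotangentModel n) p] with z hz
  rw [cotangent_target] at hz
  exact energyInChart_eq g p hz.1

theorem exists_equiv_gram_self :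
    ∃ L : Model n ≃L[ℝ] (Model n →L[ℝ] ℝ), (L : Model n →L[ℝ] Model n →L[ℝ] ℝ) =
      gram g p.proj (extChartAt (cotangentModel n) p p).1 ∧ L.symm p.2 = sharp g p.proj p.2 := by
  have h1 : (extChartAt (cotangentModel n) p p).1 = extChartAt (𝓡 n) p.proj p.proj := by
    rw [extChartAt_cotangent_self]
  rw [h1]
  obtain ⟨L, hL⟩ := exists_equiv_of_pos fun v ↦ gram_pos g (mem_extChartAt_target p.proj) (v := v)
  refine ⟨L, hL, ?_⟩
  have h2 : (L : Model n →L[ℝ] Model n →L[ℝ] ℝ) = flat g p.proj := by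
    rw [hL]
    ext u v
    exact gram_self g p.proj u v
  rw [sharp, ← h2]
  exact congrArg (fun f : (Model n →L[ℝ] ℝ) →L[ℝ] Model n ↦ f p.2)
    (ContinuousLinearMap.inverse_equiv L).symm

theorem contDiffAt_energyInChart :
    ContDiffAt ℝ ∞ (energyInChart g p) (extChartAt (cotangentModel n) p p) := by
  obtain ⟨L, hL, -⟩ := exists_equiv_gram_self g p
  refine (hasFDerivAt_half_inverse (by norm_cast) ?_ L hL
    fun u v ↦ gram_comm g _ _ u v).1.congr_of_eventuallyEq (energyInChart_eventuallyEq g p)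
  rw [extChartAt_cotangent_self]
  exact contDiffAt_gram g p.proj

theorem fderiv_energyInChart_eq_sub (ξ : Model n × (Model n →L[ℝ] ℝ)) :
    fderiv ℝ (energyInChart g p) (extChartAt (cotangentModel n) p p) ξ =
      ξ.2 (sharp g p.proj p.2) - (1 / 2) *
        fderiv ℝ (gram g p.proj) (extChartAt (𝓡 n) p.proj p.proj) ξ.1
          (sharp g p.proj p.2) (sharp g p.proj p.2) := by
  obtain ⟨L, hL, hs⟩ := exists_equiv_gram_self g p
  rw [(energyInChart_eventuallyEq g p).fderiv_eq]
  have hG : ContDiffAt ℝ ∞ (gram g p.proj) (extChartAt (cotangentModel n) p p).1 := by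
    rw [extChartAt_cotangent_self]
    exact contDiffAt_gram g p.proj
  have h := (hasFDerivAt_half_inverse (by norm_cast) hG L hL
    fun u v ↦ gram_comm g _ _ u v).2 ξ
  rw [h, extChartAt_cotangent_self, hs]

theorem apply_eq_sum {F : Type*} [NormedAddCommGroup F] [NormedSpace ℝ F] (f : Model n →L[ℝ] F)
    (v : Model n) : f v = ∑ i, v i • f (e i) := by
  have h := (EuclideanSpace.basisFun (Fin n) ℝ).sum_repr v
  conv_lhs => rw [← h]
  simp [e]

theorem dMetricComp_eq (x : M) (i j k : Fin n) :
    dMetricComp g x i j k =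
      fderiv ℝ (gram g x) (extChartAt (𝓡 n) x x) (e i) (e j) (e k) := by
  have hG := ((contDiffAt_gram g x).differentiableAt (by simp)).hasFDerivAt
  have h := (hG.clm_apply (hasFDerivAt_const (e j) _)).clm_apply (hasFDerivAt_const (e k) _)
  have h1 : metricComp g x j k = fun q ↦ gram g x q (e j) (e k) := rfl
  rw [dMetricComp, h1, h.fderiv]
  simp

theorem dMetricComp_comm (x : M) (i j k : Fin n) :
    dMetricComp g x i j k = dMetricComp g x i k j := by
  have h : metricComp g x j k = metricComp g x k j := funext fun q ↦ gram_comm g x q _ _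
  rw [dMetricComp, dMetricComp, h]

theorem christoffel_comm (x : M) (k i h : Fin n) :
    christoffel g x k i h = christoffel g x k h i := by
  simp only [christoffel]
  congr 1
  refine Finset.sum_congr rfl fun l _ ↦ ?_
  rw [dMetricComp_comm g x l i h]
  ring

variable (p : CotangentBundle n M)

theorem christoffelMap_apply (u v : Model n) :
    christoffelMap g p u v = ∑ i, ∑ h, christoffelZero g p i h * (u i * v h) := by
  simp [christoffelMap, dx]

theorem christoffelMap_comm (u v : Model n) : christoffelMap g p u v = christoffelMap g p v u := by
  rw [christoffelMap_apply, christoffelMap_apply, Finset.sum_comm]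
  refine Finset.sum_congr rfl fun i _ ↦ Finset.sum_congr rfl fun h _ ↦ ?_
  have h1 : christoffelZero g p h i = christoffelZero g p i h := by
    simp only [christoffelZero, christoffel_comm g p.proj _ h i]
  rw [h1, mul_comm (u h)]

/-- The components of `p^♯` in the preferred chart. -/
def sharpVector : Model n := sharp g p.proj p.2

theorem sum_mul_cometric_dx (l : Fin n) :
    ∑ k, p.2 (e k) * cometric g p.proj (dx k) (dx l) = sharpVector g p l := by
  have h1 : sharpVector g p l = cometric g p.proj p.2 (dx l) :=
    cometric_comm g p.proj (dx l) p.2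
  rw [h1]
  have h2 := apply_eq_sum (p.2 : Model n →L[ℝ] ℝ) (sharp g p.proj (dx l))
  refine Eq.trans ?_ h2.symm
  exact Finset.sum_congr rfl fun k _ ↦ mul_comm _ _

theorem christoffelZero_eq (i h : Fin n) :
    christoffelZero g p i h = (1 / 2) * ∑ l, sharpVector g p l *
      (dMetricComp g p.proj i h l + dMetricComp g p.proj h i l - dMetricComp g p.proj l i h) := by
  simp only [christoffelZero, christoffel, ← sum_mul_cometric_dx, Finset.mul_sum, Finset.sum_mul]
  rw [Finset.sum_comm]
  refine Finset.sum_congr rfl fun l _ ↦ Finset.sum_congr rfl fun k _ ↦ ?_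
  ring

theorem christoffelMap_apply_sharp (u : Model n) :
    christoffelMap g p u (sharpVector g p) =
      (1 / 2) * fderiv ℝ (gram g p.proj) (extChartAt (𝓡 n) p.proj p.proj) u
        (sharpVector g p) (sharpVector g p) := by
  rw [christoffelMap_apply]
  simp only [christoffelZero_eq]
  generalize sharpVector g p = y
  have h1 : fderiv ℝ (gram g p.proj) (extChartAt (𝓡 n) p.proj p.proj) u y y =
      ∑ i, ∑ h, ∑ l, u i * y h * y l * dMetricComp g p.proj i h l := by
    simp only [dMetricComp_eq]
    generalize fderiv ℝ (gram g p.proj) (extChartAt (𝓡 n) p.proj p.proj) = T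
    rw [apply_eq_sum T u]
    simp only [_root_.sum_apply, _root_.smul_apply, smul_eq_mul]
    refine Finset.sum_congr rfl fun i _ ↦ ?_
    rw [apply_eq_sum (T (e i)) y]
    simp only [_root_.sum_apply, _root_.smul_apply, smul_eq_mul,
      Finset.mul_sum]
    refine Finset.sum_congr rfl fun h _ ↦ ?_
    rw [apply_eq_sum (T (e i) (e h)) y]
    simp only [smul_eq_mul, Finset.mul_sum]
    refine Finset.sum_congr rfl fun l _ ↦ ?_
    ring
  have h2 : ∑ i, ∑ h, ∑ l, u i * y h * y l * dMetricComp g p.proj h i l =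
      ∑ i, ∑ h, ∑ l, u i * y h * y l * dMetricComp g p.proj l i h := by
    refine Finset.sum_congr rfl fun i _ ↦ ?_
    rw [Finset.sum_comm]
    refine Finset.sum_congr rfl fun h _ ↦ Finset.sum_congr rfl fun l _ ↦ ?_
    ring
  have h3 : ∑ i, ∑ h, (1 / 2 * ∑ l, y l * (dMetricComp g p.proj i h l + dMetricComp g p.proj h i l -
      dMetricComp g p.proj l i h)) * (u i * y h) = (1 / 2) *
      (∑ i, ∑ h, ∑ l, u i * y h * y l * dMetricComp g p.proj i h l +
      ∑ i, ∑ h, ∑ l, u i * y h * y l * dMetricComp g p.proj h i l -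
      ∑ i, ∑ h, ∑ l, u i * y h * y l * dMetricComp g p.proj l i h) := by
    simp only [Finset.mul_sum, Finset.sum_mul, ← Finset.sum_add_distrib, ← Finset.sum_sub_distrib]
    refine Finset.sum_congr rfl fun i _ ↦ Finset.sum_congr rfl fun h _ ↦
      Finset.sum_congr rfl fun l _ ↦ ?_
    ring
  rw [h3, h2, h1]
  ring

/-- The differential of the energy density is `g⁻¹(p, ·)` on vertical and `0` on horizontal
vectors: the Levi-Civita connection is metric. -/
theorem fderiv_energyInChart (ξ : TangentSpace (cotangentModel n) p) :
    fderiv ℝ (energyInChart g p) (extChartAt (cotangentModel n) p p) ξ =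
      cometric g p.proj p.2 (verticalPart g p ξ) := by
  refine (fderiv_energyInChart_eq_sub g p _).trans ?_
  rw [cometric_comm]
  exact congrArg (fun r ↦ _ - r) (christoffelMap_apply_sharp g p _).symm

section Chart

variable {p : CotangentBundle n M} {z : Model n × (Model n →L[ℝ] ℝ)}

theorem energyInChart_eventuallyEq_comp {w : CotangentBundle n M}
    (hz : z ∈ (extChartAt (cotangentModel n) p).target)
    (hw : (extChartAt (cotangentModel n) p).symm z ∈ (extChartAt (cotangentModel n) w).source) :
    energyInChart g p =ᶠ[𝓝 z] energyInChart g w ∘ cotangentTransition p w := by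
  filter_upwards [(continuousAt_extChartAt_symm'' hz).preimage_mem_nhds
      ((isOpen_extChartAt_source w).mem_nhds hw)] with y hy
  rw [Function.comp_apply, energyInChart, energyInChart, cotangentTransition,
    (extChartAt (cotangentModel n) w).left_inv hy]

theorem cometric_verticalPart_mfderiv (hz : z ∈ (extChartAt (cotangentModel n) p).target)
    (v : Model n × (Model n →L[ℝ] ℝ)) :
    cometric g ((extChartAt (cotangentModel n) p).symm z).proj
      ((extChartAt (cotangentModel n) p).symm z).2
      (verticalPart g ((extChartAt (cotangentModel n) p).symm z)
        (mfderiv 𝓘(ℝ, Model n × (Model n →L[ℝ] ℝ)) (cotangentModel n)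
          (extChartAt (cotangentModel n) p).symm z v)) = fderiv ℝ (energyInChart g p) z v := by
  have hw := mem_extChartAt_source (I := cotangentModel n)
    ((extChartAt (cotangentModel n) p).symm z)
  have hF := ((contDiffAt_cotangentTransition hz hw).differentiableAt (by simp)).hasFDerivAt
  have hE := ((contDiffAt_energyInChart g
    ((extChartAt (cotangentModel n) p).symm z)).differentiableAt (by simp)).hasFDerivAt
  rw [(energyInChart_eventuallyEq_comp g hz hw).fderiv_eq, mfderiv_cotangent_symm hz,
    (HasFDerivAt.comp z hE hF).fderiv]
  exact (fderiv_energyInChart g _ _).symm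

theorem snd_horizontalPart_mfderiv (hz : z ∈ (extChartAt (cotangentModel n) p).target)
    (v : Model n × (Model n →L[ℝ] ℝ)) :
    ((extChartAt (cotangentModel n) p).symm z).2
      (horizontalPart ((extChartAt (cotangentModel n) p).symm z)
        (mfderiv 𝓘(ℝ, Model n × (Model n →L[ℝ] ℝ)) (cotangentModel n)
          (extChartAt (cotangentModel n) p).symm z v)) = z.2 v.1 := by
  have hw := mem_extChartAt_source (I := cotangentModel n)
    ((extChartAt (cotangentModel n) p).symm z)
  rw [mfderiv_cotangent_symm hz, ← liouville_cotangentTransition hz hw v]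
  have h : cotangentTransition p ((extChartAt (cotangentModel n) p).symm z) z = _ :=
    extChartAt_cotangent_self ((extChartAt (cotangentModel n) p).symm z)
  rw [h]
  rfl

theorem verticalPart_horizontalPart_mfderiv (hz : z ∈ (extChartAt (cotangentModel n) p).target)
    (u v : Model n × (Model n →L[ℝ] ℝ)) :
    verticalPart g ((extChartAt (cotangentModel n) p).symm z)
        (mfderiv 𝓘(ℝ, Model n × (Model n →L[ℝ] ℝ)) (cotangentModel n)
          (extChartAt (cotangentModel n) p).symm z u)
      (horizontalPart ((extChartAt (cotangentModel n) p).symm z)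
        (mfderiv 𝓘(ℝ, Model n × (Model n →L[ℝ] ℝ)) (cotangentModel n)
          (extChartAt (cotangentModel n) p).symm z v)) -
    verticalPart g ((extChartAt (cotangentModel n) p).symm z)
        (mfderiv 𝓘(ℝ, Model n × (Model n →L[ℝ] ℝ)) (cotangentModel n)
          (extChartAt (cotangentModel n) p).symm z v)
      (horizontalPart ((extChartAt (cotangentModel n) p).symm z)
        (mfderiv 𝓘(ℝ, Model n × (Model n →L[ℝ] ℝ)) (cotangentModel n)
          (extChartAt (cotangentModel n) p).symm z u)) = u.2 v.1 - v.2 u.1 := by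
  have hw := mem_extChartAt_source (I := cotangentModel n)
    ((extChartAt (cotangentModel n) p).symm z)
  have key : ∀ (w : CotangentBundle n M) (ξ ζ : Model n × (Model n →L[ℝ] ℝ)),
      (ξ.2 - christoffelMap g w ξ.1) ζ.1 - (ζ.2 - christoffelMap g w ζ.1) ξ.1 =
        ξ.2 ζ.1 - ζ.2 ξ.1 := by
    intro w ξ ζ
    rw [_root_.sub_apply, _root_.sub_apply, christoffelMap_comm g w ξ.1 ζ.1]
    ring
  rw [mfderiv_cotangent_symm hz, ← symplectic_cotangentTransition hz hw u v]
  exact key _ _ _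

/-- The fundamental form in the induced chart:
`Ω = λ(t) dp_i ∧ dq^i + μ(t) dt ∧ p_i dq^i`. -/
theorem inChart_fundamentalForm (hn : 2 ≤ n) [Nonempty M] {A : EndoCoeffs} {C : MetricCoeffs}
    (hA : A.IsPositive) (h : IsAlmostHermitian g A C) {lam mu : ℝ → ℝ}
    (hP : IsProportionality A C lam mu) (hz : z ∈ (extChartAt (cotangentModel n) p).target) :
    (fundamentalForm h).inChart p z = twoForm (Model n × (Model n →L[ℝ] ℝ))
      (lam (energyInChart g p z) • liouville (Model n) +
        mu (energyInChart g p z) •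
          (fderiv ℝ (energyInChart g p) z).smulRight (liouville (Model n) z)) := by
  ext v
  refine (fundamentalBilin_eq g hn hA h hP _ _ _).trans ?_
  have h1 := cometric_verticalPart_mfderiv g hz
  have h2 := snd_horizontalPart_mfderiv hz
  have h3 := verticalPart_horizontalPart_mfderiv g hz (v 0) (v 1)
  refine (congrArg₂ (fun a b ↦ lam (energyInChart g p z) * a + mu (energyInChart g p z) * b) h3
    (congrArg₂ (· - ·) (congrArg₂ (· * ·) (h1 (v 0)) (h2 (v 1)))
      (congrArg₂ (· * ·) (h1 (v 1)) (h2 (v 0))))).trans ?_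
  rw [twoForm_apply]
  simp [liouville_apply]
  ring

end Chart

/-- `dΩ = (λ'(t) - μ(t)) dt ∧ dp_i ∧ dq^i`. -/
theorem extDerivAt_fundamentalForm (hn : 2 ≤ n) [Nonempty M] {A : EndoCoeffs} {C : MetricCoeffs}
    (hA : A.IsPositive) (h : IsAlmostHermitian g A C) {lam mu : ℝ → ℝ}
    (hP : IsProportionality A C lam mu) (p : CotangentBundle n M)
    (v : Fin 3 → Model n × (Model n →L[ℝ] ℝ)) :
    (fundamentalForm h).extDerivAt p v =
      (derivWithin lam (Ici 0) (energy g p) - mu (energy g p)) *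
        (cometric g p.proj p.2 (verticalPart g p (v 0)) *
            ((v 1).2 (v 2).1 - (v 2).2 (v 1).1) -
          cometric g p.proj p.2 (verticalPart g p (v 1)) *
            ((v 0).2 (v 2).1 - (v 2).2 (v 0).1) +
          cometric g p.proj p.2 (verticalPart g p (v 2)) *
            ((v 0).2 (v 1).1 - (v 1).2 (v 0).1)) := by
  have h1 : (fundamentalForm h).inChart p =ᶠ[𝓝 (extChartAt (cotangentModel n) p p)]
      fun z ↦ twoForm (Model n × (Model n →L[ℝ] ℝ))
        (lam (energyInChart g p z) • liouville (Model n) +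
          mu (energyInChart g p z) •
            (fderiv ℝ (energyInChart g p) z).smulRight (liouville (Model n) z)) := by
    filter_upwards [extChartAt_target_mem_nhds (I := cotangentModel n) p] with z hz
    exact inChart_fundamentalForm g hn hA h hP hz
  have h2 : (fundamentalForm h).extDerivAt p v =
      extDeriv ((fundamentalForm h).inChart p) (extChartAt (cotangentModel n) p p) v := by
    rw [DiffForm.extDerivAt, mfderiv_extChartAt_self]
    rfl
  have h3 : energyInChart g p (extChartAt (cotangentModel n) p p) = energy g p := by
    rw [energyInChart, extChartAt_to_inv]
  rw [h2, h1.extDeriv_eq]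
  refine (extDeriv_twoForm_add_wedge ((contDiffAt_energyInChart g p).of_le (by norm_cast))
    (fun z ↦ energy_nonneg g _) (hP.smooth_lam.differentiableOn (by simp))
    (hP.smooth_mu.differentiableOn (by simp)) (liouville (Model n)) v).trans ?_
  have e0 := fderiv_energyInChart g p (v 0)
  have e1 := fderiv_energyInChart g p (v 1)
  have e2 := fderiv_energyInChart g p (v 2)
  rw [h3, e0, e1, e2]
  rfl

theorem isClosed_fundamentalForm_iff (hn : 2 ≤ n) [Nonempty M] {A : EndoCoeffs} {C : MetricCoeffs}
    (hA : A.IsPositive) (h : IsAlmostHermitian g A C) {lam mu : ℝ → ℝ}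
    (hP : IsProportionality A C lam mu) :
    (fundamentalForm h).IsClosed ↔ ∀ t : ℝ, 0 ≤ t → mu t = derivWithin lam (Ici 0) t := by
  constructor
  · intro hcl
    have hpos : ∀ t : ℝ, 0 < t → mu t = derivWithin lam (Ici 0) t := by
      intro t ht
      obtain ⟨p, -, rfl⟩ := exists_energy_eq g hn (Classical.arbitrary M) ht.le
      obtain ⟨X, hX, hpX⟩ := exists_ne_zero_apply_eq_zero hn p.2
      have h1 := extDerivAt_fundamentalForm g hn hA h hP p
        ![verticalLift p p.2, horizontalLift g p X, verticalLift p (flat g p.proj X)]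
      rw [hcl p] at h1
      have c0 : cometric g p.proj p.2 (verticalPart g p (verticalLift p p.2)) =
          2 * energy g p := by
        rw [verticalPart_verticalLift, energy]; ring
      have c1 : cometric g p.proj p.2 (verticalPart g p (horizontalLift g p X)) = 0 := by
        rw [verticalPart_horizontalLift, cometric_comm]; rfl
      have c2 : cometric g p.proj p.2
          (verticalPart g p (verticalLift p (flat g p.proj X))) = 0 := by
        rw [verticalPart_verticalLift, cometric_flat, hpX]
      have c3 : (christoffelMap g p X) 0 - (flat g p.proj X : Model n →L[ℝ] ℝ) X =
          - g.inner p.proj X X := by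
        rw [ContinuousLinearMap.map_zero, zero_sub]; rfl
      have h2 : (0 : ℝ) = (derivWithin lam (Ici 0) (energy g p) - mu (energy g p)) *
        (cometric g p.proj p.2 (verticalPart g p (verticalLift p p.2)) *
            ((christoffelMap g p X) 0 - (flat g p.proj X : Model n →L[ℝ] ℝ) X) -
          cometric g p.proj p.2 (verticalPart g p (horizontalLift g p X)) * _ +
          cometric g p.proj p.2
          (verticalPart g p (verticalLift p (flat g p.proj X))) * _) := h1
      rw [c0, c1, c2, c3, zero_mul, zero_mul, sub_zero, add_zero] at h2
      have hN := g.pos p.proj X hX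
      have h3 : 2 * energy g p * -g.inner p.proj X X ≠ 0 :=
        mul_ne_zero (by linarith) (neg_ne_zero.2 hN.ne')
      have h4 := (mul_eq_zero.1 h2.symm).resolve_right h3
      linarith
    have hmu : ContinuousOn mu (Ici 0) := hP.smooth_mu.continuousOn
    have hlam : ContinuousOn (derivWithin lam (Ici 0)) (Ici 0) :=
      hP.smooth_lam.continuousOn_derivWithin (uniqueDiffOn_Ici 0) (by norm_cast)
    have hcl' : Ici (0 : ℝ) ⊆ closure (Ioi 0) := by rw [closure_Ioi]
    have heq : EqOn mu (derivWithin lam (Ici 0)) (Ioi 0) := fun t ht ↦ hpos t ht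
    exact fun t ht ↦ heq.of_subset_closure hmu hlam Ioi_subset_Ici_self hcl' ht
  · intro hmu p
    ext v
    rw [extDerivAt_fundamentalForm g hn hA h hP p v, hmu _ (energy_nonneg g p), sub_self, zero_mul]
    rfl

end NaturalLift

end

theorem mainTheorem3 {n : ℕ} (hn : 2 ≤ n) {M : Type*} [TopologicalSpace M]
    [ChartedSpace (NaturalLift.Model n) M] [IsManifold (𝓡 n) ∞ M] [Nonempty M]
    (g : NaturalLift.Metric n M) (A : NaturalLift.EndoCoeffs) (C : NaturalLift.MetricCoeffs)
    (hA : A.IsPositive) (h : NaturalLift.IsAlmostHermitian g A C) :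
    (∃ lam mu : ℝ → ℝ, NaturalLift.IsProportionality A C lam mu) ∧
      ∀ lam mu : ℝ → ℝ, NaturalLift.IsProportionality A C lam mu →
        ((NaturalLift.fundamentalForm h).IsClosed ↔
          ∀ t : ℝ, 0 ≤ t → mu t = derivWithin lam (Ici 0) t) :=
  ⟨h.exists_isProportionality hn hA,
    fun _ _ hP ↦ NaturalLift.isClosed_fundamentalForm_iff g hn hA h hP⟩
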